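/- Let $\xi=(\xi_s)_{s\ge 0}$ be a one-dimensional Lévy process, that is, a real-valued process with $\xi_0=0$ a.s., stationary and independent increments and almost surely right-continuous paths, and assume $\lim_{s\to\infty}\xi_s=\infty$ a.s. Let $U(dy)=\int_0^\infty \mathbb P(\xi_s\in dy)\,ds$ be its potential measure. For $x\in\mathbb R$ and a Borel set $E\subseteq\mathbb R$, call $\mathbb R\setminus E$ *$\mathbb P^x$-transient* if almost surely there is $\tau\ge 0$ with $x+\xi_s\in E$ for all $s\ge\tau$. For $f:\mathbb R\to[0,\infty)$ say that *the integral test holds for $f$* if for every $x\in\mathbb R$ $$\mathbb P\Big(\int_0^\infty f(x+\xi_s)\,ds<\infty\Big)=0\iff \int_{\{y:\,x+y\in E\}} f(x+y)\,U(dy)=\infty\ \text{ for all Borel } E \text{ with } \mathbb R\setminus E\ \mathbb P^x\text{-transient},$$ and if, moreover, whenever the integral on the right is finite for some such $E$, then $\int_0^\infty f(x+\xi_s)\,ds<\infty$ almost surely. 1. Let $f:\mathbb R\to[0,\infty)$ be locally bounded, and suppose that on a Borel set $L\subseteq\mathbb R$ it is the pointwise limit of a non-decreasing sequence of functions $f_n=\sum_{j=1}^{k(n)}c^{(n)}_j\mathbb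 I_{(\alpha^{(n)}_j,\beta^{(n)}_j)}$ with real $\alpha^{(n)}_j<\beta^{(n)}_j$ and $c^{(n)}_j\ge 0$. If $\mathbb P(x+\xi_s\in L^c)=0$ for all $s>0$ and $x\in\mathbb R$, then the integral test holds for $f$. 2. If $\mathbb P(x+\xi_s\in A)=0$ for all $s>0$, all $x\in\mathbb R$ and every set $A$ of zero Lebesgue measure, then the integral test holds for every locally bounded, (Lebesgue) measurable $f:\mathbb R\to[0,\infty)$. This assumption on $\xi$ is satisfied whenever the law of $\xi_s$ is absolutely continuous for every $s>0$. 3. Both 1 and 2 remain true with "locally bounded" replaced by "locally integrable" (with respect to Lebesgue measure), provided that for all $t>0$ and $x\in\mathbb R$ one has $\int_0^t f(x+\xi_s)\,ds<\infty$ almost surely. -/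

import Mathlib

open MeasureTheory ProbabilityTheory Filter Set Topology
open scoped NNReal ENNReal

noncomputable section

namespace Perpetual

/-- A one-dimensional Lévy process: a real-valued process started at `0`, with independent and
stationary increments and almost surely right-continuous paths. -/
structure IsLevyProcess {Ω : Type*} [MeasurableSpace Ω] (P : Measure Ω)
    (ξ : ℝ≥0 → Ω → ℝ) : Prop where
  measurable : ∀ s, Measurable (ξ s)
  zero : ∀ᵐ ω ∂P, ξ 0 ω = 0
  indep : HasIndepIncrements ξ P
  stationary : ∀ s t : ℝ≥0,
    IdentDistrib (fun ω => ξ (s + t) ω - ξ s ω) (fun ω => ξ t ω - ξ 0 ω) P P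
  rightCts : ∀ᵐ ω ∂P, ∀ t : ℝ≥0, ContinuousWithinAt (fun s => ξ s ω) (Ici t) t

/-- The path escapes to `+∞` almost surely. -/
def DriftsToInfinity {Ω : Type*} [MeasurableSpace Ω] (P : Measure Ω)
    (ξ : ℝ≥0 → Ω → ℝ) : Prop :=
  ∀ᵐ ω ∂P, Tendsto (fun s => ξ s ω) atTop atTop

/-- The potential measure `U(dx) = ∫₀^∞ P(ξ_s ∈ dx) ds`. -/
def potentialMeasure {Ω : Type*} [MeasurableSpace Ω] (P : Measure Ω)
    (ξ : ℝ≥0 → Ω → ℝ) : Measure ℝ :=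
  (volume.restrict (Ioi (0 : ℝ))).bind (fun s => P.map (ξ s.toNNReal))

/-- A Lévy process is jointly measurable up to null sets. -/
theorem IsLevyProcess.aemeasurable_prod {Ω : Type*} [MeasurableSpace Ω] {P : Measure Ω} [IsProbabilityMeasure P]
    {ξ : ℝ≥0 → Ω → ℝ} (hξ : IsLevyProcess P ξ) :
    AEMeasurable (fun p : ℝ × Ω => ξ p.1.toNNReal p.2)
      ((volume.restrict (Ioi (0 : ℝ))).prod P) := by
  refine aemeasurable_of_tendsto_metrizable_ae atTop
    (f := fun (n : ℕ) (p : ℝ × Ω) => ξ ((⌊p.1.toNNReal * (n + 1)⌋₊ + 1 : ℕ) / (n + 1)) p.2) ?_ ?_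
  · intro n
    have h : Measurable (fun q : ℕ × Ω => ξ ((q.1 + 1 : ℕ) / (n + 1 : ℝ≥0)) q.2) :=
      measurable_from_prod_countable_right fun k => hξ.measurable ((k + 1 : ℕ) / (n + 1 : ℝ≥0))
    have h2 : Measurable (fun p : ℝ × Ω => ((⌊p.1.toNNReal * (n + 1)⌋₊ : ℕ), p.2)) := by
      refine Measurable.prodMk (Nat.measurable_floor.comp ?_) measurable_snd
      fun_prop
    exact (h.comp h2).aemeasurable
  · have h := (Measure.quasiMeasurePreserving_snd
      (μ := volume.restrict (Ioi (0 : ℝ))) (ν := P)).ae hξ.rightCts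
    filter_upwards [h] with p hp
    refine (hp p.1.toNNReal).tendsto.comp (tendsto_nhdsWithin_iff.2 ⟨?_, ?_⟩)
    · have h0 : Tendsto (fun n : ℕ => p.1.toNNReal + 1 / ((n : ℝ≥0) + 1)) atTop
          (𝓝 (p.1.toNNReal + 0)) :=
        tendsto_const_nhds.add tendsto_one_div_add_atTop_nhds_zero_nat
      rw [add_zero] at h0
      refine tendsto_of_tendsto_of_tendsto_of_le_of_le tendsto_const_nhds h0 ?_ ?_
      · intro n
        show p.1.toNNReal ≤ _
        rw [le_div_iff₀ (by positivity)]
        push_cast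
        exact (Nat.lt_floor_add_one _).le
      · intro n
        show _ ≤ p.1.toNNReal + 1 / ((n : ℝ≥0) + 1)
        rw [div_le_iff₀ (by positivity), add_mul, one_div, inv_mul_cancel₀ (by positivity)]
        push_cast
        gcongr
        exact Nat.floor_le (by positivity)
    · refine Eventually.of_forall fun n => ?_
      show p.1.toNNReal ≤ _
      rw [le_div_iff₀ (by positivity)]
      push_cast
      exact (Nat.lt_floor_add_one _).le

/-- The potential measure of a Borel set is the expected occupation time `∫₀^∞ P(ξ_s ∈ A) ds`. -/
theorem potentialMeasure_apply {Ω : Type*} [MeasurableSpace Ω] {P : Measure Ω}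
    [IsProbabilityMeasure P] {ξ : ℝ≥0 → Ω → ℝ} (hξ : IsLevyProcess P ξ) {A : Set ℝ}
    (hA : MeasurableSet A) :
    potentialMeasure P ξ A =
      ∫⁻ s in Ioi (0 : ℝ), P {ω | ξ s.toNNReal ω ∈ A} := by
  have hm := hξ.aemeasurable_prod
  have hae : AEMeasurable (fun s : ℝ => P.map (ξ s.toNNReal)) (volume.restrict (Ioi (0 : ℝ))) := by
    refine ⟨fun s => P.map (fun ω => hm.mk _ (s, ω)), ?_, ?_⟩
    · refine Measure.measurable_of_measurable_coe _ fun B hB => ?_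
      have : ∀ s, P.map (fun ω => hm.mk _ (s, ω)) B = P (Prod.mk s ⁻¹' (hm.mk _ ⁻¹' B)) := fun s =>
        Measure.map_apply (hm.measurable_mk.comp measurable_prodMk_left) hB
      simp_rw [this]
      exact measurable_measure_prodMk_left (hm.measurable_mk hB)
    · filter_upwards [Measure.ae_ae_of_ae_prod hm.ae_eq_mk] with s hs
      exact Measure.map_congr hs
  rw [potentialMeasure, Measure.bind_apply hA hae]
  exact lintegral_congr fun s => Measure.map_apply (hξ.measurable _) hA

/-- The perpetual integral `∫₀^∞ f(x + ξ_s) ds ∈ [0, ∞]`. -/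
def perpetualIntegral {Ω : Type*} (ξ : ℝ≥0 → Ω → ℝ) (f : ℝ → ℝ≥0) (x : ℝ) (ω : Ω) : ℝ≥0∞ :=
  ∫⁻ s in Ioi (0 : ℝ), (f (x + ξ s.toNNReal ω) : ℝ≥0∞)

/-- The finite-horizon integral `∫₀^t f(x + ξ_s) ds ∈ [0, ∞]`. -/
def horizonIntegral {Ω : Type*} (ξ : ℝ≥0 → Ω → ℝ) (f : ℝ → ℝ≥0) (x t : ℝ) (ω : Ω) : ℝ≥0∞ :=
  ∫⁻ s in Ioc (0 : ℝ) t, (f (x + ξ s.toNNReal ω) : ℝ≥0∞)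

/-- All finite-horizon integrals are almost surely finite, for every starting point. -/
def FiniteHorizon {Ω : Type*} [MeasurableSpace Ω] (P : Measure Ω)
    (ξ : ℝ≥0 → Ω → ℝ) (f : ℝ → ℝ≥0) : Prop :=
  ∀ t : ℝ, 0 < t → ∀ x : ℝ, ∀ᵐ ω ∂P, horizonIntegral ξ f x t ω < ∞

/-- The set `A` is transient for `x + ξ`: almost surely `x + ξ` stays outside `A` from some time
on. -/
def IsTransientFrom {Ω : Type*} [MeasurableSpace Ω] (P : Measure Ω)
    (ξ : ℝ≥0 → Ω → ℝ) (x : ℝ) (A : Set ℝ) : Prop :=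
  ∀ᵐ ω ∂P, ∃ τ : ℝ≥0, ∀ s : ℝ≥0, τ ≤ s → x + ξ s ω ∈ Aᶜ

/-- The expected time integral of `f` along `x + ξ` over the part of the path in `E`, as an
integral against the potential measure: the variable of integration is the displacement `y`, and
the position `x + y` is restricted to `E`. -/
def potentialIntegral {Ω : Type*} [MeasurableSpace Ω] (P : Measure Ω)
    (ξ : ℝ≥0 → Ω → ℝ) (f : ℝ → ℝ≥0) (x : ℝ) (E : Set ℝ) : ℝ≥0∞ :=
  ∫⁻ y in {y : ℝ | x + y ∈ E}, (f (x + y) : ℝ≥0∞) ∂(potentialMeasure P ξ)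

/-- The integral test for `f` and every starting point `x`: the perpetual integral is almost surely
infinite iff the potential integral of `f` over every Borel `E` with transient complement is
infinite; and if one of these potential integrals is finite, then the perpetual integral is almost
surely finite. -/
def IntegralTest {Ω : Type*} [MeasurableSpace Ω] (P : Measure Ω)
    (ξ : ℝ≥0 → Ω → ℝ) (f : ℝ → ℝ≥0) : Prop :=
  ∀ x : ℝ,
    (P {ω | perpetualIntegral ξ f x ω < ∞} = 0 ↔
      ∀ E : Set ℝ, MeasurableSet E → IsTransientFrom P ξ x Eᶜ →
        potentialIntegral P ξ f x E = ∞) ∧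
    ((∃ E : Set ℝ, MeasurableSet E ∧ IsTransientFrom P ξ x Eᶜ ∧
        potentialIntegral P ξ f x E < ∞) →
      ∀ᵐ ω ∂P, perpetualIntegral ξ f x ω < ∞)

/-- `f` is bounded on every compact set. -/
def LocallyBounded (f : ℝ → ℝ≥0) : Prop :=
  ∀ K : Set ℝ, IsCompact K → BddAbove (f '' K)

/-- A finite sum `∑ⱼ cⱼ 𝟙_{(αⱼ, βⱼ)}` with `cⱼ ≥ 0` and `αⱼ < βⱼ`. -/
def IsOpenStepFunction (g : ℝ → ℝ≥0) : Prop :=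
  ∃ (k : ℕ) (c : Fin k → ℝ≥0) (α β : Fin k → ℝ), (∀ j, α j < β j) ∧
    ∀ y, g y = ∑ j, (Ioo (α j) (β j)).indicator (fun _ => c j) y

/-- On `L`, `f` is the pointwise limit of a non-decreasing sequence of step functions on open
intervals. -/
def IsMonotoneStepLimitOn (f : ℝ → ℝ≥0) (L : Set ℝ) : Prop :=
  ∃ g : ℕ → ℝ → ℝ≥0, (∀ n, IsOpenStepFunction (g n)) ∧ Monotone g ∧
    ∀ y ∈ L, Tendsto (fun n => g n y) atTop (𝓝 (f y))

/-- At each fixed time `s > 0`, and from each starting point, the process is almost surely not in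
`A`. -/
def NotCharged {Ω : Type*} [MeasurableSpace Ω] (P : Measure Ω)
    (ξ : ℝ≥0 → Ω → ℝ) (A : Set ℝ) : Prop :=
  ∀ s : ℝ≥0, 0 < s → ∀ x : ℝ, P {ω | x + ξ s ω ∈ A} = 0

/-- The process charges no Lebesgue-null set. -/
def ChargesNoNullSet {Ω : Type*} [MeasurableSpace Ω] (P : Measure Ω)
    (ξ : ℝ≥0 → Ω → ℝ) : Prop :=
  ∀ A : Set ℝ, volume A = 0 → NotCharged P ξ A

end Perpetual

end

/-! Let `g` be a Borel version of `f`, equal to it off a set that the process does not charge. Write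
I(y) for the integral of `g` along y + ξ, H(y) for the probability that I(y) is finite, and ψ(y) for
the probability that I(y) > 1.

Sufficiency: a finite potential integral over E makes the integral of `g` over the visits to E
almost surely finite. The path is eventually in E, and the initial time segment contributes a finite
amount by the finite-horizon bound.

Necessity: suppose p = H(x) > 0. A finite initial segment does not affect finiteness, so H is a
bounded harmonic function for every ξ_t, and a variance argument (`ae_eq_of_harmonic`) gives H(x +
ξ_t) = p almost surely for each fixed t. Put O = {ψ > 1 - p/2}. From a point of O with H = p, the
integral lies in (1, ∞) with probability at least p/2. Hence p/2 times the probability of visiting O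
after time n is at most the probability that the tail from n exceeds 1 while the total is finite.
This tends to 0, so O is transient. Off O, the remaining integral is at most 1 with probability at
least p/2. On each path, the mass collected while the remaining mass is at most 1 is itself at most
1, so the expected integral over the complement of O is at most 2/p.

Lower semicontinuity of ψ makes O open. By right-continuity, visits to O are then seen at countably
many deterministic times, so the Markov property at fixed times suffices and no stopping times are
needed. Semicontinuity comes from Fatou when `g` is itself lower semicontinuous, and from the
smoothing effect of absolutely continuous marginals when no null set is charged. -/

namespace Perpetual

/-! ### Increments of a Lévy process -/

section Increments

variable {Ω : Type*} [MeasurableSpace Ω] {P : Measure Ω} {ξ : ℝ≥0 → Ω → ℝ}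

/-- The process of increments of `ξ` after time `t`. -/
noncomputable def shift (ξ : ℝ≥0 → Ω → ℝ) (t : ℝ≥0) (ω : Ω) : ℝ≥0 → ℝ :=
  fun u => ξ (t + u) ω - ξ t ω

/-- Places finitely many times on one monotone grid starting at 0, so that values of the process
become partial sums of independent increments. The membership of `σ N` serves only to carry the
induction. -/
theorem exists_monotone_enum (I : Finset ℝ≥0) :
    ∃ σ : ℕ → ℝ≥0, Monotone σ ∧ σ 0 = 0 ∧ ∃ N, σ N ∈ insert 0 I ∧
      ∀ u ∈ I, ∃ k ≤ N, σ k = u := by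
  induction I using Finset.induction_on_max with
  | empty => exact ⟨fun _ => 0, monotone_const, rfl, 0, by simp, by simp⟩
  | insert a I ha ih =>
    obtain ⟨σ, hm, h0, N, hN, hk⟩ := ih
    have hNa : σ N ≤ a := by
      rcases Finset.mem_insert.1 hN with h | h
      · simp [h]
      · exact (ha _ h).le
    refine ⟨fun i => if i ≤ N then σ i else a, ?_, by simp [h0], N + 1, by simp, ?_⟩
    · intro i j hij
      dsimp only
      split_ifs with h1 h2 h2
      · exact hm hij
      · exact (hm h1).trans hNa
      · omega
      · exact le_rfl
    · intro u hu
      rcases Finset.mem_insert.1 hu with rfl | hu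
      · exact ⟨N + 1, le_rfl, by simp⟩
      · obtain ⟨k, hk1, hk2⟩ := hk u hu
        exact ⟨k, by omega, by simp [hk1, hk2]⟩

theorem IsLevyProcess.measurable_shift (hξ : IsLevyProcess P ξ) (t : ℝ≥0) :
    Measurable (shift ξ t) :=
  measurable_pi_lambda _ fun u => (hξ.measurable (t + u)).sub (hξ.measurable t)

theorem IsLevyProcess.measurable_path (hξ : IsLevyProcess P ξ) :
    Measurable (fun ω s => ξ s ω) :=
  measurable_pi_lambda _ hξ.measurable

theorem IsLevyProcess.identDistrib_sub (hξ : IsLevyProcess P ξ) {a b a' b' : ℝ≥0}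
    (hab : a ≤ b) (hab' : a' ≤ b') (h : b - a = b' - a') :
    IdentDistrib (fun ω => ξ b ω - ξ a ω) (fun ω => ξ b' ω - ξ a' ω) P P := by
  have h1 := hξ.stationary a (b - a)
  have h2 := hξ.stationary a' (b' - a')
  rw [add_tsub_cancel_of_le hab] at h1
  rw [add_tsub_cancel_of_le hab', ← h] at h2
  exact h1.trans h2.symm

/-- Finite-dimensional marginals determine the law. Each is the same function of a sequence of
independent grid increments, whose individual laws do not depend on the time shift. -/
theorem IsLevyProcess.map_shift_eq_map_shift_zero [IsProbabilityMeasure P]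
    (hξ : IsLevyProcess P ξ) (t : ℝ≥0) :
    P.map (shift ξ t) = P.map (shift ξ 0) := by
  refine (map_eq_iff_forall_finset_map_restrict_eq
    (X := fun u ω => shift ξ t ω u) (Y := fun u ω => shift ξ 0 ω u)
    (hξ.measurable_shift t).aemeasurable (hξ.measurable_shift 0).aemeasurable).2 fun I => ?_
  obtain ⟨σ, hm, h0, N, -, hk⟩ := exists_monotone_enum I
  choose! k hkN hk using hk
  let Φ : (ℕ → ℝ) → (I → ℝ) := fun v u => ∑ i ∈ Finset.range (k u), v i
  have hΦ : Measurable Φ := by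
    refine measurable_pi_lambda _ fun u => ?_
    exact Finset.measurable_sum _ fun i _ => measurable_pi_apply i
  have key : ∀ r : ℝ≥0, (fun ω => I.restrict (shift ξ r ω)) =
      Φ ∘ fun ω i => ξ (r + σ (i + 1)) ω - ξ (r + σ i) ω := by
    intro r
    ext ω u
    simp only [Φ, Function.comp, Finset.restrict]
    rw [Finset.sum_range_sub (fun i => ξ (r + σ i) ω), hk u u.2, h0, add_zero, shift]
  have hmr : ∀ r : ℝ≥0, Monotone fun i => r + σ i := fun r i j hij => by
    dsimp only
    gcongr
    exact hm hij
  have hid : IdentDistrib (fun ω i => ξ (t + σ (i + 1)) ω - ξ (t + σ i) ω)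
      (fun ω i => ξ (0 + σ (i + 1)) ω - ξ (0 + σ i) ω) P P := by
    refine IdentDistrib.pi (X := fun i ω => ξ (t + σ (i + 1)) ω - ξ (t + σ i) ω)
      (Y := fun i ω => ξ (0 + σ (i + 1)) ω - ξ (0 + σ i) ω) (fun i => ?_)
      (hξ.indep.nat (hmr t)) (hξ.indep.nat (hmr 0))
    refine hξ.identDistrib_sub (hmr t (Nat.le_succ i)) (hmr 0 (Nat.le_succ i)) ?_
    rw [add_tsub_add_eq_tsub_left, add_tsub_add_eq_tsub_left]
  change P.map (fun ω => I.restrict (shift ξ t ω)) = P.map (fun ω => I.restrict (shift ξ 0 ω))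
  rw [key t, key 0]
  exact (hid.comp hΦ).map_eq

theorem IsLevyProcess.shift_zero_ae_eq (hξ : IsLevyProcess P ξ) :
    shift ξ 0 =ᵐ[P] fun ω s => ξ s ω := by
  filter_upwards [hξ.zero] with ω hω
  ext u
  simp [shift, hω]

theorem IsLevyProcess.map_shift [IsProbabilityMeasure P] (hξ : IsLevyProcess P ξ)
    (t : ℝ≥0) :
    P.map (shift ξ t) = P.map (fun ω s => ξ s ω) :=
  (hξ.map_shift_eq_map_shift_zero t).trans (Measure.map_congr hξ.shift_zero_ae_eq)

/-- On a grid containing t, finite families of past and future values are functions of two disjoint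
blocks of independent increments. -/
theorem IsLevyProcess.indepFun_past_shift [IsProbabilityMeasure P]
    (hξ : IsLevyProcess P ξ) (t : ℝ≥0) :
    IndepFun (fun ω (s : Iic t) => ξ s ω) (shift ξ t) P := by
  -- Grid sums only produce values relative to time 0; the initial value vanishes almost surely and
  -- is removed at the end.
  have hsub : IndepFun (fun ω (s : Iic t) => ξ s ω - ξ 0 ω) (shift ξ t) P := by
    refine IndepFun.process_indepFun_process (X := fun (s : Iic t) ω => ξ s ω - ξ 0 ω)
      (Y := fun u ω => shift ξ t ω u)
      (fun s => (hξ.measurable s).sub (hξ.measurable 0))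
      (fun u => (hξ.measurable (t + u)).sub (hξ.measurable t)) fun I J => ?_
    classical
    obtain ⟨σ, hm, h0, N, -, hk⟩ := exists_monotone_enum
      (insert t (I.image Subtype.val ∪ J.image (t + ·)))
    choose! k hkN hk using hk
    let m := k t
    have hmt : σ m = t := hk t (by simp)
    have hmN : m ≤ N := hkN t (by simp)
    have hindep := (hξ.indep.nat hm).indepFun_finset (Finset.range m) (Finset.Ico m N)
      (by rw [Finset.range_eq_Ico]; exact Finset.Ico_disjoint_Ico_consecutive 0 m N)
      fun i => (hξ.measurable _).sub (hξ.measurable _)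
    let Φ : (Finset.range m → ℝ) → I → ℝ := fun v s =>
      ∑ i : Finset.range m, if (i : ℕ) < k s then v i else 0
    let Ψ : (Finset.Ico m N → ℝ) → J → ℝ := fun v u =>
      ∑ i : Finset.Ico m N, if (i : ℕ) < k (t + u) then v i else 0
    have hΦ : Measurable Φ := by
      refine measurable_pi_lambda _ fun s => Finset.measurable_sum _ fun i _ => ?_
      split_ifs
      exacts [measurable_pi_apply i, measurable_const]
    have hΨ : Measurable Ψ := by
      refine measurable_pi_lambda _ fun s => Finset.measurable_sum _ fun i _ => ?_
      split_ifs
      exacts [measurable_pi_apply i, measurable_const]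
    have h := hindep.comp hΦ hΨ
    convert h using 1
    · ext ω s
      have hs : ((s : Iic t) : ℝ≥0) ≤ t := s.1.2
      have hks : σ (k s) = s := hk s (Finset.mem_insert_of_mem
        (Finset.mem_union_left _ (Finset.mem_image_of_mem _ s.2)))
      -- The grid may repeat t, so the index of a time s ≤ t can exceed `m`; in that case s = t.
      have hkm : ξ (s : Iic t) ω = ξ (σ (min (k s) m)) ω := by
        rcases le_total (k s) m with h | h
        · rw [min_eq_left h, hks]
        · have : t ≤ (s : Iic t) := hmt.symm.le.trans ((hm h).trans hks.le)
          rw [min_eq_right h, hmt, le_antisymm hs this]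
      simp only [Φ, Function.comp]
      rw [Finset.sum_coe_sort (Finset.range m)
        (fun i => if i < k s then ξ (σ (i + 1)) ω - ξ (σ i) ω else 0), ← Finset.sum_filter]
      have : (Finset.range m).filter (· < k s) = Finset.range (min (k s) m) := by
        ext; simp; omega
      rw [this, Finset.sum_range_sub (fun i => ξ (σ i) ω), h0, hkm]
    · ext ω u
      have hku : σ (k (t + u)) = t + u := hk _ (by simp)
      have hkN' : k (t + u) ≤ N := hkN _ (by simp)
      simp only [Ψ, Function.comp]
      rw [Finset.sum_coe_sort (Finset.Ico m N)
        (fun i => if i < k (t + u) then ξ (σ (i + 1)) ω - ξ (σ i) ω else 0),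
        ← Finset.sum_filter]
      have : (Finset.Ico m N).filter (· < k (t + u)) = Finset.Ico m (k (t + u)) := by
        ext; simp; omega
      rw [this, shift]
      rcases le_total m (k (t + u)) with h | h
      · rw [Finset.sum_Ico_eq_sub _ h, Finset.sum_range_sub (fun i => ξ (σ i) ω),
          Finset.sum_range_sub (fun i => ξ (σ i) ω), hku, hmt]
        ring
      · have h1 : σ (k (t + u)) ≤ σ m := hm h
        rw [hku, hmt] at h1
        rw [Finset.Ico_eq_empty_of_le h, le_antisymm h1 le_self_add]
        simp
  refine IndepFun.congr hsub ?_ EventuallyEq.rfl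
  filter_upwards [hξ.zero] with ω hω
  ext s
  simp [hω]

theorem IsLevyProcess.isLevyProcess_shift (hξ : IsLevyProcess P ξ) (t : ℝ≥0) :
    IsLevyProcess P (fun u ω => shift ξ t ω u) where
  measurable u := (hξ.measurable (t + u)).sub (hξ.measurable t)
  zero := by simp [shift]
  indep n τ hτ := by
    have := hξ.indep n (fun i => t + τ i) fun i j hij => by
      dsimp only
      gcongr
      exact hτ hij
    simpa [shift] using this
  stationary s u := by
    simp only [shift, sub_sub_sub_cancel_right, add_zero]
    refine hξ.identDistrib_sub (by gcongr; simp) (by simp) ?_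
    rw [add_tsub_add_eq_tsub_left]
    simp
  rightCts := by
    filter_upwards [hξ.rightCts] with ω hω u
    refine ContinuousWithinAt.sub ?_ continuousWithinAt_const
    refine (hω (t + u)).comp (f := fun s => t + s) (by fun_prop) ?_
    intro s hs
    simpa using hs

/-- The events determined by the process up to time `t`. -/
abbrev past (ξ : ℝ≥0 → Ω → ℝ) (t : ℝ≥0) : MeasurableSpace Ω :=
  MeasurableSpace.comap (fun ω (s : Iic t) => ξ s ω) inferInstance

theorem past_mono {Ω : Type*} {ξ : ℝ≥0 → Ω → ℝ} {s t : ℝ≥0} (h : s ≤ t) : past ξ s ≤ past ξ t := by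
  rintro _ ⟨A, hA, rfl⟩
  refine ⟨(fun w (r : Iic s) => w ⟨r, r.2.trans h⟩) ⁻¹' A, ?_, rfl⟩
  exact (measurable_pi_lambda _ fun r => measurable_pi_apply _) hA

theorem IsLevyProcess.past_le (hξ : IsLevyProcess P ξ) (t : ℝ≥0) : past ξ t ≤ ‹_› :=
  (measurable_pi_lambda (fun ω (s : Iic t) => ξ s ω) fun s => hξ.measurable s).comap_le

theorem measurable_past {Ω : Type*} {ξ : ℝ≥0 → Ω → ℝ} {s t : ℝ≥0} (h : s ≤ t) :
    Measurable[past ξ t] (ξ s) :=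
  (measurable_pi_apply (⟨s, h⟩ : Iic t)).comp (comap_measurable fun ω (r : Iic t) => ξ r ω)

/-- The Markov property: given the past, the increments after time `t` are distributed as the
process itself. -/
theorem IsLevyProcess.setLIntegral_shift [IsProbabilityMeasure P] (hξ : IsLevyProcess P ξ)
    (t : ℝ≥0) {C : Set Ω} (hC : MeasurableSet[past ξ t] C) {G : ℝ × (ℝ≥0 → ℝ) → ℝ≥0∞}
    (hG : Measurable G) :
    ∫⁻ ω in C, G (ξ t ω, shift ξ t ω) ∂P =
      ∫⁻ ω in C, (∫⁻ w, G (ξ t ω, w) ∂(P.map fun ω s => ξ s ω)) ∂P := by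
  obtain ⟨A, hA, rfl⟩ := hC
  set X : Ω → (Iic t → ℝ) := fun ω s => ξ s ω with hX
  have hXm : Measurable X := measurable_pi_lambda _ fun s => hξ.measurable s
  have hYm := hξ.measurable_shift t
  have hprod := (hξ.indepFun_past_shift t).map_prod_eq_prod_map_map hXm.aemeasurable
    hYm.aemeasurable
  rw [hξ.map_shift t] at hprod
  set μ := P.map fun ω s => ξ s ω
  have : IsProbabilityMeasure μ := Measure.isProbabilityMeasure_map hξ.measurable_path.aemeasurable
  let e : Iic t := ⟨t, self_mem_Iic⟩
  let H : (Iic t → ℝ) × (ℝ≥0 → ℝ) → ℝ≥0∞ := fun p =>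
    A.indicator 1 p.1 * G (p.1 e, p.2)
  have hH : Measurable H := by
    refine Measurable.mul ((measurable_one.indicator hA).comp measurable_fst) (hG.comp ?_)
    fun_prop
  have hmA : MeasurableSet (X ⁻¹' A) := hXm hA
  have h1 : ∫⁻ ω in X ⁻¹' A, G (ξ t ω, shift ξ t ω) ∂P = ∫⁻ ω, H (X ω, shift ξ t ω) ∂P := by
    rw [← lintegral_indicator hmA]
    refine lintegral_congr fun ω => ?_
    by_cases h : X ω ∈ A
    · rw [indicator_of_mem (by exact h)]
      simp [H, h, e, X]
    · rw [indicator_of_notMem (by exact h)]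
      simp [H, h]
  have h2 : ∫⁻ ω, H (X ω, shift ξ t ω) ∂P = ∫⁻ p, H p ∂((P.map X).prod μ) := by
    rw [← hprod, lintegral_map hH (hXm.prodMk hYm)]
  rw [h1, h2, lintegral_prod _ hH.aemeasurable,
    lintegral_map hH.lintegral_prod_right' hXm, ← lintegral_indicator hmA]
  refine lintegral_congr fun ω => ?_
  by_cases h : X ω ∈ A
  · rw [indicator_of_mem (by exact h)]
    simp [H, h, e, X]
  · rw [indicator_of_notMem (by exact h)]
    simp [H, h]

end Increments

/-! ### Bounded harmonic functions of a random walk -/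

section Harmonic

variable {ν : Measure ℝ} [IsProbabilityMeasure ν]

theorem integrable_of_measurable_of_bounded {α : Type*} [MeasurableSpace α] {μ : Measure α}
    [IsFiniteMeasure μ] {g : α → ℝ} (hg : Measurable g) {c : ℝ} (hc : ∀ a, |g a| ≤ c) :
    Integrable g μ :=
  Integrable.of_bound hg.aestronglyMeasurable c (Eventually.of_forall hc)

theorem integral_sub_const_sq {α : Type*} [MeasurableSpace α] {μ : Measure α}
    [IsProbabilityMeasure μ] {g : α → ℝ} (hg : Integrable g μ)
    (hg2 : Integrable (fun a => g a ^ 2) μ) (m : ℝ) :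
    ∫ a, (g a - m) ^ 2 ∂μ = ∫ a, g a ^ 2 ∂μ - 2 * m * ∫ a, g a ∂μ + m ^ 2 := by
  have h : ∀ a, (g a - m) ^ 2 = (g a ^ 2 - 2 * m * g a) + m ^ 2 := fun a => by ring
  simp_rw [h]
  rw [integral_add (f := fun a => g a ^ 2 - 2 * m * g a) (hg2.sub (hg.const_mul _))
    (integrable_const _), integral_sub hg2 (hg.const_mul _), integral_const_mul]
  simp

theorem sq_integral_le {α : Type*} [MeasurableSpace α] {μ : Measure α}
    [IsProbabilityMeasure μ] {g : α → ℝ} (hg : Measurable g) {c : ℝ} (hc : ∀ a, |g a| ≤ c) :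
    (∫ a, g a ∂μ) ^ 2 ≤ ∫ a, g a ^ 2 ∂μ := by
  have h1 : Integrable g μ := integrable_of_measurable_of_bounded hg hc
  have h2 : Integrable (fun a => g a ^ 2) μ :=
    integrable_of_measurable_of_bounded (hg.pow_const 2) (c := c ^ 2) fun a => by
      rw [abs_pow]
      exact pow_le_pow_left₀ (abs_nonneg _) (hc a) 2
  have h3 : 0 ≤ ∫ a, (g a - ∫ a, g a ∂μ) ^ 2 ∂μ := integral_nonneg fun a => sq_nonneg _
  rw [integral_sub_const_sq h1 h2] at h3
  nlinarith

/-- A bounded harmonic function of a random walk does not change along the walk. -/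
theorem ae_eq_of_harmonic {h : ℝ → ℝ} (hm : Measurable h) (h0 : ∀ y, 0 ≤ h y)
    (h1 : ∀ y, h y ≤ 1) (hh : ∀ y, h y = ∫ z, h (y + z) ∂ν) (y : ℝ) :
    ∀ᵐ z ∂ν, h (y + z) = h y := by
  have hd : ∀ a b, |h a - h b| ≤ 1 := fun a b =>
    abs_sub_le_iff.2 ⟨by linarith [h0 b, h1 a], by linarith [h0 a, h1 b]⟩
  have hd2 : ∀ a b, (h a - h b) ^ 2 ≤ 1 := fun a b => by
    rw [← sq_abs]
    exact pow_le_one₀ (abs_nonneg _) (hd a b)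
  have hsq : ∀ a, |h a ^ 2| ≤ 1 := fun a => by
    rw [abs_of_nonneg (sq_nonneg _)]
    exact pow_le_one₀ (h0 a) (h1 a)
  -- The one-step variance, to be shown zero. By harmonicity it is the gain of `h ^ 2` under one
  -- averaging step.
  let v : ℝ → ℝ := fun y => ∫ z, (h (y + z) - h y) ^ 2 ∂ν
  have hv0 : ∀ y, 0 ≤ v y := fun y => integral_nonneg fun z => sq_nonneg _
  have hvm : Measurable v := by
    have : Measurable (fun p : ℝ × ℝ => (h (p.1 + p.2) - h p.1) ^ 2) := by fun_prop
    exact this.stronglyMeasurable.integral_prod_right.measurable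
  have hint2 : ∀ y, Integrable (fun z => (h (y + z) - h y) ^ 2) ν := fun y =>
    integrable_of_measurable_of_bounded (by fun_prop) (c := 1) fun z => by
      rw [abs_of_nonneg (sq_nonneg _)]
      exact hd2 _ _
  have hv1 : ∀ y, v y ≤ 1 := fun y => by
    refine (integral_mono (hint2 y) (integrable_const 1) fun z => hd2 _ _).trans ?_
    simp
  have hhsq : ∀ y, Integrable (fun z => h (y + z) ^ 2) ν := fun y =>
    integrable_of_measurable_of_bounded (by fun_prop) fun z => hsq _
  have hhi : ∀ y, Integrable (fun z => h (y + z)) ν := fun y =>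
    integrable_of_measurable_of_bounded (by fun_prop) (c := 1) fun z => by
      rw [abs_of_nonneg (h0 _)]
      exact h1 _
  have hvi : ∀ y, Integrable (fun z => v (y + z)) ν := fun y =>
    integrable_of_measurable_of_bounded (by fun_prop) (c := 1) fun z => by
      rw [abs_of_nonneg (hv0 _)]
      exact hv1 _
  have e1 : ∀ y, ∫ z, h (y + z) ^ 2 ∂ν = h y ^ 2 + v y := by
    intro y
    have : v y = _ := integral_sub_const_sq (hhi y) (hhsq y) (h y)
    rw [this, ← hh]
    ring
  -- Steps commute, so `h (y + z') - h y` is the average over z of `h (y + z + z') - h (y + z)`;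
  -- Jensen for the square then shows that `v` is subharmonic.
  have e2 : ∀ y, v y ≤ ∫ z, v (y + z) ∂ν := by
    intro y
    have hF : Measurable (fun p : ℝ × ℝ => (h (y + p.2 + p.1) - h (y + p.2)) ^ 2) := by fun_prop
    have hFi : Integrable (fun p : ℝ × ℝ => (h (y + p.2 + p.1) - h (y + p.2)) ^ 2) (ν.prod ν) :=
      integrable_of_measurable_of_bounded hF (c := 1) fun z => by
        rw [abs_of_nonneg (sq_nonneg _)]
        exact hd2 _ _
    have hswap : ∫ z', ∫ z, (h (y + z + z') - h (y + z)) ^ 2 ∂ν ∂ν = ∫ z, v (y + z) ∂ν :=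
      integral_integral_swap hFi
    rw [← hswap]
    refine integral_mono (hint2 y) hFi.integral_prod_left fun z' => ?_
    have : h (y + z') - h y = ∫ z, (h (y + z + z') - h (y + z)) ∂ν := by
      rw [integral_sub _ (hhi y), ← hh, hh (y + z')]
      · simp_rw [add_right_comm]
      · refine integrable_of_measurable_of_bounded (by fun_prop) (c := 1) fun z => ?_
        rw [abs_of_nonneg (h0 _)]
        exact h1 _
    dsimp only
    rw [this]
    exact sq_integral_le (by fun_prop) fun z => hd _ _
  -- `g` is the n-fold average of `h ^ 2`. Each averaging gains at least one more `v`, while the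
  -- bound 1 persists, which forces `v` to vanish.
  have e3 : ∀ n : ℕ, ∃ g : ℝ → ℝ, Measurable g ∧ (∀ y, g y ≤ 1) ∧
      ∀ y, h y ^ 2 + n * v y ≤ g y := by
    intro n
    induction n with
    | zero => exact ⟨fun y => h y ^ 2, by fun_prop, fun y => (le_abs_self _).trans (hsq y),
        by simp⟩
    | succ n ih =>
      obtain ⟨g, hgm, hg1, hg⟩ := ih
      have hg0 : ∀ y, 0 ≤ g y := fun y =>
        (add_nonneg (sq_nonneg _) (mul_nonneg n.cast_nonneg (hv0 y))).trans (hg y)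
      have hgi : ∀ y, Integrable (fun z => g (y + z)) ν := fun y =>
        integrable_of_measurable_of_bounded (by fun_prop) (c := 1) fun z => by
          rw [abs_of_nonneg (hg0 _)]
          exact hg1 _
      refine ⟨fun y => ∫ z, g (y + z) ∂ν, ?_, fun y => ?_, fun y => ?_⟩
      · have : Measurable (fun p : ℝ × ℝ => g (p.1 + p.2)) := by fun_prop
        exact this.stronglyMeasurable.integral_prod_right.measurable
      · refine (integral_mono (hgi y) (integrable_const 1) fun z => hg1 _).trans ?_
        simp
      · have := integral_mono ((hhsq y).add ((hvi y).const_mul n)) (hgi y) fun z => hg (y + z)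
        simp only [Pi.add_apply] at this
        rw [integral_add (hhsq y) ((hvi y).const_mul n), integral_const_mul, e1] at this
        push_cast
        nlinarith [mul_le_mul_of_nonneg_left (e2 y) (n.cast_nonneg (α := ℝ))]
  have e4 : v y = 0 := by
    by_contra hne
    have hpos : 0 < v y := lt_of_le_of_ne (hv0 y) (Ne.symm hne)
    obtain ⟨n, hn⟩ := exists_nat_gt (1 / v y)
    obtain ⟨g, -, hg1, hg⟩ := e3 n
    rw [div_lt_iff₀ hpos] at hn
    linarith [hg y, hg1 y, sq_nonneg (h y)]
  have := (integral_eq_zero_iff_of_nonneg (fun z => sq_nonneg _) (hint2 y)).1 e4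
  filter_upwards [this] with z hz
  exact sub_eq_zero.1 (pow_eq_zero_iff two_ne_zero |>.1 hz)

end Harmonic

/-! ### A maximal inequality -/

section Maximal

variable {Ω : Type*} [MeasurableSpace Ω] {P : Measure Ω} {ξ : ℝ≥0 → Ω → ℝ}

/-- Split the union according to the first time in `S` at which `D` occurs. The pieces are disjoint
and known at their own times, so the hypothesis applies to each and the bounds add up. -/
theorem IsLevyProcess.mul_measure_biUnion_le (hξ : IsLevyProcess P ξ) {D : ℝ≥0 → Set Ω}
    {V : Set Ω} {c : ℝ≥0∞} (S : Finset ℝ≥0) (hD : ∀ t, MeasurableSet[past ξ t] (D t))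
    (h : ∀ t, ∀ C, MeasurableSet[past ξ t] C → C ⊆ D t → c * P C ≤ P (C ∩ V)) :
    c * P (⋃ t ∈ S, D t) ≤ P V := by
  let C : ℝ≥0 → Set Ω := fun t => D t \ ⋃ s ∈ S.filter (· < t), D s
  have hC : ∀ t, MeasurableSet[past ξ t] (C t) := fun t => by
    refine (hD t).diff (Finset.measurableSet_biUnion _ fun s hs => ?_)
    exact past_mono (Finset.mem_filter.1 hs).2.le _ (hD s)
  have hCm : ∀ t, MeasurableSet (C t) := fun t => hξ.past_le t _ (hC t)
  have hsub : ⋃ t ∈ S, D t ⊆ ⋃ t ∈ S, C t := by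
    intro ω hω
    simp only [mem_iUnion, exists_prop] at hω ⊢
    obtain ⟨t, ⟨htS, ht⟩, hmin⟩ := (S.finite_toSet.inter_of_left {t | ω ∈ D t}).isCompact
      |>.exists_isLeast hω
    refine ⟨t, htS, ht, ?_⟩
    simp only [mem_iUnion, exists_prop, Finset.mem_filter, not_exists, not_and]
    intro s ⟨hsS, hst⟩ hs
    exact absurd (hmin ⟨hsS, hs⟩) (not_le.2 hst)
  have hdisj : (S : Set ℝ≥0).PairwiseDisjoint C := by
    intro s hs t ht hst
    have aux : ∀ s ∈ S, ∀ t, s < t → Disjoint (C s) (C t) := by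
      intro s hs t hlt
      refine disjoint_left.2 fun ω h1 h2 => h2.2 ?_
      simp only [mem_iUnion, exists_prop, Finset.mem_filter]
      exact ⟨s, ⟨hs, hlt⟩, h1.1⟩
    rcases lt_or_gt_of_ne hst with hlt | hlt
    · exact aux s hs t hlt
    · exact (aux t ht s hlt).symm
  calc c * P (⋃ t ∈ S, D t) ≤ c * ∑ t ∈ S, P (C t) := by
        gcongr
        exact (measure_mono hsub).trans (measure_biUnion_finset_le _ _)
    _ = ∑ t ∈ S, c * P (C t) := Finset.mul_sum _ _ _
    _ ≤ ∑ t ∈ S, P.restrict V (C t) := by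
        refine Finset.sum_le_sum fun t _ => ?_
        rw [Measure.restrict_apply (hCm t)]
        exact h t _ (hC t) sdiff_subset
    _ = P.restrict V (⋃ t ∈ S, C t) := (measure_biUnion_finset hdisj fun t _ => hCm t).symm
    _ ≤ P.restrict V univ := measure_mono (subset_univ _)
    _ = P V := by simp

/-- A right-continuous path that visits an open set stays there for a while, and `J` also extends to
the right. A countable dense set of times therefore detects the visit, and the finite case passes to
the increasing limit. -/
theorem IsLevyProcess.mul_measure_exists_mem_le (hξ : IsLevyProcess P ξ) {O : Set ℝ}
    (hO : IsOpen O) {J : Set ℝ≥0} (hJ : ∀ t ∈ J, J ∈ 𝓝[>] t) {V : Set Ω} {c : ℝ≥0∞}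
    (h : ∀ t ∈ J, ∀ C, MeasurableSet[past ξ t] C → (∀ ω ∈ C, ξ t ω ∈ O) →
      c * P C ≤ P (C ∩ V)) :
    c * P {ω | ∃ t ∈ J, ξ t ω ∈ O} ≤ P V := by
  let D : ℝ≥0 → Set Ω := fun t => {ω | t ∈ J ∧ ξ t ω ∈ O}
  let q := TopologicalSpace.denseSeq ℝ≥0
  have hsub : P {ω | ∃ t ∈ J, ξ t ω ∈ O} ≤ P (⋃ n, D (q n)) := by
    refine measure_mono_ae ?_
    filter_upwards [hξ.rightCts] with ω hω
    rintro ⟨t, htJ, ht⟩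
    have h1 : ∀ᶠ s in 𝓝[>] t, ξ s ω ∈ O :=
      ((hω t).mono Ioi_subset_Ici_self).eventually (hO.mem_nhds ht)
    have h2 := h1.and (hJ t htJ)
    obtain ⟨b, hb, hsub⟩ := (mem_nhdsGT_iff_exists_Ioo_subset' (show t < t + 1 by simp)).1 h2
    obtain ⟨n, hn⟩ := (TopologicalSpace.denseRange_denseSeq ℝ≥0).exists_mem_open isOpen_Ioo
      (nonempty_Ioo.2 hb)
    exact mem_iUnion.2 ⟨n, (hsub hn).2, (hsub hn).1⟩
  refine (mul_le_mul_right hsub c).trans ?_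
  rw [measure_iUnion_eq_iSup_accumulate, ENNReal.mul_iSup]
  refine iSup_le fun n => ?_
  have hacc : accumulate (fun n => D (q n)) n = ⋃ t ∈ (Finset.range (n + 1)).image q, D t := by
    ext ω
    simp [mem_accumulate]
  rw [hacc]
  refine hξ.mul_measure_biUnion_le _ (fun t => ?_) fun t C hC hCD => ?_
  · by_cases htJ : t ∈ J
    · simp only [D, htJ, true_and]
      exact measurable_past le_rfl hO.measurableSet
    · have : D t = ∅ := subset_eq_empty (fun ω hω => htJ hω.1) rfl
      rw [this]
      exact @MeasurableSet.empty _ (past ξ t)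
  · by_cases htJ : t ∈ J
    · exact h t htJ C hC fun ω hω => (hCD hω).2
    · have : C = ∅ := subset_eq_empty (fun ω hω => htJ (hCD hω).1) rfl
      simp [this]

end Maximal

/-! ### Integral functionals of paths -/

section PathFunctionals

/-- The value at `s` of the right limit of a path along a fixed sequence of discrete times. -/
noncomputable def rightEval (s : ℝ≥0) (w : ℝ≥0 → ℝ) : ℝ :=
  limsup (fun n : ℕ => w ((⌊s * (n + 1)⌋₊ + 1 : ℕ) / (n + 1 : ℝ≥0))) atTop

/-- Plain evaluation is not jointly measurable for the product σ-algebra on paths; this substitute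
is, and it agrees with evaluation wherever the path is right-continuous. -/
theorem measurable_rightEval : Measurable fun p : ℝ≥0 × (ℝ≥0 → ℝ) => rightEval p.1 p.2 := by
  refine Measurable.limsup fun n => ?_
  have h : Measurable (fun q : ℕ × (ℝ≥0 → ℝ) => q.2 ((q.1 + 1 : ℕ) / (n + 1 : ℝ≥0))) :=
    measurable_from_prod_countable_right fun k =>
      measurable_pi_apply (((k + 1 : ℕ) : ℝ≥0) / (n + 1 : ℝ≥0))
  have h2 : Measurable (fun p : ℝ≥0 × (ℝ≥0 → ℝ) => ((⌊p.1 * (n + 1)⌋₊ : ℕ), p.2)) := by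
    refine Measurable.prodMk (Nat.measurable_floor.comp ?_) measurable_snd
    fun_prop
  exact h.comp h2

theorem rightEval_eq {s : ℝ≥0} {w : ℝ≥0 → ℝ} (hw : ContinuousWithinAt w (Ici s) s) :
    rightEval s w = w s := by
  have hge : ∀ n : ℕ, s ≤ (⌊s * (n + 1)⌋₊ + 1 : ℕ) / (n + 1 : ℝ≥0) := fun n => by
    rw [le_div_iff₀ (by positivity)]
    push_cast
    exact (Nat.lt_floor_add_one _).le
  refine Tendsto.limsup_eq (hw.tendsto.comp (tendsto_nhdsWithin_iff.2
    ⟨?_, Eventually.of_forall hge⟩))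
  have h0 : Tendsto (fun n : ℕ => s + 1 / ((n : ℝ≥0) + 1)) atTop (𝓝 (s + 0)) :=
    tendsto_const_nhds.add tendsto_one_div_add_atTop_nhds_zero_nat
  rw [add_zero] at h0
  refine tendsto_of_tendsto_of_tendsto_of_le_of_le tendsto_const_nhds h0 hge fun n => ?_
  show _ ≤ s + 1 / ((n : ℝ≥0) + 1)
  rw [div_le_iff₀ (by positivity), add_mul, one_div, inv_mul_cancel₀ (by positivity)]
  push_cast
  gcongr
  exact Nat.floor_le (by positivity)

/-- The integral of `g` along the path `y + w`. -/
noncomputable def pathIntegral (g : ℝ → ℝ≥0∞) (y : ℝ) (w : ℝ≥0 → ℝ) : ℝ≥0∞ :=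
  ∫⁻ s in Ioi (0 : ℝ), g (y + rightEval s.toNNReal w)

theorem measurable_pathIntegral {g : ℝ → ℝ≥0∞} (hg : Measurable g) :
    Measurable fun p : ℝ × (ℝ≥0 → ℝ) => pathIntegral g p.1 p.2 := by
  have : Measurable fun q : (ℝ × (ℝ≥0 → ℝ)) × ℝ =>
      g (q.1.1 + rightEval q.2.toNNReal q.1.2) := by
    refine hg.comp (Measurable.add (by fun_prop) ?_)
    exact measurable_rightEval.comp (f := fun q : (ℝ × (ℝ≥0 → ℝ)) × ℝ => (q.2.toNNReal, q.1.2))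
      (by fun_prop)
  exact this.lintegral_prod_right'

/-- The integral of `g` along `x + ξ` after time `t`. -/
noncomputable def tailIntegral {Ω : Type*} (ξ : ℝ≥0 → Ω → ℝ) (g : ℝ → ℝ≥0∞) (x : ℝ)
    (t : ℝ≥0) (ω : Ω) : ℝ≥0∞ :=
  ∫⁻ s in Ioi (t : ℝ), g (x + ξ s.toNNReal ω)

theorem setLIntegral_Ioi_comp_add (F : ℝ → ℝ≥0∞) (t : ℝ) :
    ∫⁻ u in Ioi (0 : ℝ), F (t + u) = ∫⁻ s in Ioi t, F s := by
  have h := (measurePreserving_add_left volume t).setLIntegral_comp_preimage_emb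
    (measurableEmbedding_addLeft t) F (Ioi t)
  simpa using h

/-- The total `g`-mass collected once the remaining mass is at most one is at most one. -/
theorem setLIntegral_indicator_remaining_le_one (g : ℝ → ℝ≥0∞) :
    ∫⁻ s in Ioi (0 : ℝ), {s | ∫⁻ u in Ioi s, g u ≤ 1}.indicator g s ≤ 1 := by
  set S : Set ℝ := {s | ∫⁻ u in Ioi s, g u ≤ 1}
  refine (lintegral_indicator_le g S).trans ?_
  rw [Measure.restrict_restrict' measurableSet_Ioi]
  rcases (S ∩ Ioi 0).eq_empty_or_nonempty with h | h
  · simp [h]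
  have hbdd : BddBelow (S ∩ Ioi 0) := ⟨0, fun s hs => hs.2.le⟩
  set a := sInf (S ∩ Ioi 0)
  have hsub : S ∩ Ioi 0 ⊆ Ici a := fun s hs => csInf_le hbdd hs
  -- The infimum is not known to lie in `S`, so the bound is obtained just beyond it and extended by
  -- monotone convergence.
  have hup : ∀ n : ℕ, ∫⁻ u in Ioi (a + 1 / (n + 1)), g u ≤ 1 := fun n => by
    obtain ⟨s, hs, hlt⟩ := exists_lt_of_csInf_lt h
      (show a < a + 1 / ((n : ℝ) + 1) by simp; positivity)
    exact (lintegral_mono_set (Ioi_subset_Ioi hlt.le)).trans hs.1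
  have hU : Ioi a = ⋃ n : ℕ, Ioi (a + 1 / ((n : ℝ) + 1)) := by
    ext s
    simp only [mem_Ioi, mem_iUnion]
    constructor
    · intro hs
      obtain ⟨n, hn⟩ := exists_nat_one_div_lt (sub_pos.2 hs)
      exact ⟨n, by linarith⟩
    · rintro ⟨n, hn⟩
      have : (0 : ℝ) < 1 / (n + 1) := by positivity
      linarith
  refine (lintegral_mono_set hsub).trans ?_
  rw [setLIntegral_congr Ioi_ae_eq_Ici.symm, hU, setLIntegral_iUnion_of_directed]
  · exact iSup_le hup
  · refine directed_of_isDirected_le fun m n hmn => Ioi_subset_Ioi ?_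
    have : (1 : ℝ) / (n + 1) ≤ 1 / (m + 1) := Nat.one_div_le_one_div hmn
    linarith

end PathFunctionals

/-! ### Integral functionals of a Lévy process -/

section ProcessFunctionals

variable {Ω : Type*} [MeasurableSpace Ω] {P : Measure Ω} {ξ : ℝ≥0 → Ω → ℝ}

/-- The probability that the integral of `g` along `y + ξ` lies in `B`. -/
noncomputable def integralLaw (P : Measure Ω) (ξ : ℝ≥0 → Ω → ℝ) (g : ℝ → ℝ≥0∞)
    (B : Set ℝ≥0∞) (y : ℝ) : ℝ≥0∞ :=
  P.map (fun ω s => ξ s ω) {w | pathIntegral g y w ∈ B}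

variable {g : ℝ → ℝ≥0∞}

theorem IsLevyProcess.isProbabilityMeasure_map_path [IsProbabilityMeasure P]
    (hξ : IsLevyProcess P ξ)
    :
    IsProbabilityMeasure (P.map fun ω s => ξ s ω) :=
  Measure.isProbabilityMeasure_map hξ.measurable_path.aemeasurable

theorem measurable_integralLaw [IsProbabilityMeasure P] (hξ : IsLevyProcess P ξ)
    (hg : Measurable g) {B : Set ℝ≥0∞}
    (hB : MeasurableSet B) : Measurable (integralLaw P ξ g B) := by
  have := hξ.isProbabilityMeasure_map_path
  exact measurable_measure_prodMk_left (measurable_pathIntegral hg hB)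

theorem IsLevyProcess.tailIntegral_eq (hξ : IsLevyProcess P ξ) (g : ℝ → ℝ≥0∞) :
    ∀ᵐ ω ∂P, ∀ y t, tailIntegral ξ g y t ω = pathIntegral g (y + ξ t ω) (shift ξ t ω) := by
  filter_upwards [hξ.rightCts] with ω hω y t
  rw [tailIntegral, pathIntegral, ← setLIntegral_Ioi_comp_add]
  refine setLIntegral_congr_fun measurableSet_Ioi fun u hu => ?_
  have hu' : (0 : ℝ) ≤ u := le_of_lt hu
  have hc : ContinuousWithinAt (shift ξ t ω) (Ici u.toNNReal) u.toNNReal := by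
    refine ContinuousWithinAt.sub ?_ continuousWithinAt_const
    refine (hω (t + u.toNNReal)).comp (f := fun s => t + s) (by fun_prop) ?_
    intro s hs
    simpa using hs
  rw [rightEval_eq hc, shift, Real.toNNReal_add t.coe_nonneg hu', Real.toNNReal_coe]
  ring_nf

theorem IsLevyProcess.aemeasurable_tailIntegral (hξ : IsLevyProcess P ξ) (hg : Measurable g)
    (y : ℝ) (t : ℝ≥0) : AEMeasurable (tailIntegral ξ g y t) P := by
  refine ⟨fun ω => pathIntegral g (y + ξ t ω) (shift ξ t ω), ?_, ?_⟩
  · exact (measurable_pathIntegral hg).comp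
      (((hξ.measurable t).const_add y).prodMk (hξ.measurable_shift t))
  · filter_upwards [hξ.tailIntegral_eq g] with ω h using h y t

theorem IsLevyProcess.measure_inter_tailIntegral_mem [IsProbabilityMeasure P]
    (hξ : IsLevyProcess P ξ)
    (hg : Measurable g) {B : Set ℝ≥0∞} (hB : MeasurableSet B) (y : ℝ) (t : ℝ≥0) {C : Set Ω}
    (hC : MeasurableSet[past ξ t] C) :
    P (C ∩ {ω | tailIntegral ξ g y t ω ∈ B}) =
      ∫⁻ ω in C, integralLaw P ξ g B (y + ξ t ω) ∂P := by
  have hA : MeasurableSet {p : ℝ × (ℝ≥0 → ℝ) | pathIntegral g (y + p.1) p.2 ∈ B} :=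
    (measurable_pathIntegral hg).comp (f := fun p : ℝ × (ℝ≥0 → ℝ) => (y + p.1, p.2))
      (by fun_prop) hB
  have h := hξ.setLIntegral_shift t hC (G := indicator _ 1) (measurable_one.indicator hA)
  have hCm := hξ.past_le t _ hC
  have hpre : MeasurableSet {ω | pathIntegral g (y + ξ t ω) (shift ξ t ω) ∈ B} :=
    ((hξ.measurable t).prodMk (hξ.measurable_shift t)) hA
  have e1 : P (C ∩ {ω | tailIntegral ξ g y t ω ∈ B}) =
      ∫⁻ ω in C, indicator {p : ℝ × (ℝ≥0 → ℝ) | pathIntegral g (y + p.1) p.2 ∈ B} 1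
        (ξ t ω, shift ξ t ω) ∂P := by
    have : P (C ∩ {ω | tailIntegral ξ g y t ω ∈ B}) =
        P ({ω | pathIntegral g (y + ξ t ω) (shift ξ t ω) ∈ B} ∩ C) := by
      refine measure_congr ?_
      filter_upwards [hξ.tailIntegral_eq g] with ω hω
      have := hω y t
      refine propext ?_
      change (ω ∈ C ∧ tailIntegral ξ g y t ω ∈ B) ↔ (pathIntegral g _ _ ∈ B ∧ ω ∈ C)
      rw [this, and_comm]
    rw [this, ← Measure.restrict_apply hpre, ← lintegral_indicator_one hpre]
    rfl
  rw [e1, h]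
  refine lintegral_congr fun ω => ?_
  have hB' : MeasurableSet {w | pathIntegral g (y + ξ t ω) w ∈ B} := measurable_prodMk_left hA
  rw [integralLaw, ← lintegral_indicator_one hB']
  rfl

theorem IsLevyProcess.measure_tailIntegral_mem [IsProbabilityMeasure P] (hξ : IsLevyProcess P ξ)
    (hg : Measurable g) {B : Set ℝ≥0∞} (hB : MeasurableSet B) (y : ℝ) (t : ℝ≥0) :
    P {ω | tailIntegral ξ g y t ω ∈ B} = ∫⁻ ω, integralLaw P ξ g B (y + ξ t ω) ∂P := by
  have := hξ.measure_inter_tailIntegral_mem hg hB y t (C := univ) MeasurableSet.univ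
  simpa using this

theorem IsLevyProcess.measure_tailIntegral_zero_mem [IsProbabilityMeasure P]
    (hξ : IsLevyProcess P ξ)
    (hg : Measurable g) {B : Set ℝ≥0∞} (hB : MeasurableSet B) (y : ℝ) :
    P {ω | tailIntegral ξ g y 0 ω ∈ B} = integralLaw P ξ g B y := by
  rw [hξ.measure_tailIntegral_mem hg hB]
  have : ∀ᵐ ω ∂P, integralLaw P ξ g B (y + ξ 0 ω) = integralLaw P ξ g B y := by
    filter_upwards [hξ.zero] with ω hω
    rw [hω, add_zero]
  rw [lintegral_congr_ae this]
  simp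

/-- All integrals of `g` over bounded time intervals are almost surely finite. -/
def FiniteOnBounded (P : Measure Ω) (ξ : ℝ≥0 → Ω → ℝ) (g : ℝ → ℝ≥0∞) : Prop :=
  ∀ t : ℝ, 0 < t → ∀ x : ℝ, ∀ᵐ ω ∂P, ∫⁻ s in Ioc (0 : ℝ) t, g (x + ξ s.toNNReal ω) < ∞

theorem FiniteOnBounded.tailIntegral_zero_lt_top (hfin : FiniteOnBounded P ξ g) (x : ℝ)
    (t : ℝ≥0) : ∀ᵐ ω ∂P, tailIntegral ξ g x t ω < ∞ → tailIntegral ξ g x 0 ω < ∞ := by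
  rcases eq_or_ne t 0 with rfl | ht
  · exact Eventually.of_forall fun _ h => h
  have ht' : (0 : ℝ) < t := NNReal.coe_pos.2 (pos_iff_ne_zero.2 ht)
  filter_upwards [hfin t ht' x] with ω hω h
  rw [tailIntegral, NNReal.coe_zero, ← Ioc_union_Ioi_eq_Ioi ht'.le,
    lintegral_union measurableSet_Ioi (Ioc_disjoint_Ioi le_rfl)]
  exact ENNReal.add_lt_top.2 ⟨hω, h⟩

theorem tailIntegral_anti {Ω : Type*} {ξ : ℝ≥0 → Ω → ℝ} (x : ℝ) (ω : Ω) :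
    Antitone fun t => tailIntegral ξ g x t ω :=
  fun _ _ hst => lintegral_mono_set (Ioi_subset_Ioi (NNReal.coe_le_coe.2 hst))

theorem tendsto_tailIntegral {Ω : Type*} {ξ : ℝ≥0 → Ω → ℝ} {x : ℝ} {ω : Ω}
    (h : tailIntegral ξ g x 0 ω < ∞) :
    Tendsto (fun n : ℕ => tailIntegral ξ g x n ω) atTop (𝓝 0) := by
  set κ := (volume : Measure ℝ).withDensity fun s => g (x + ξ s.toNNReal ω)
  have hκ : ∀ t : ℝ≥0, κ (Ioi (t : ℝ)) = tailIntegral ξ g x t ω := fun t =>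
    withDensity_apply _ measurableSet_Ioi
  have := tendsto_measure_iInter_atTop (μ := κ) (s := fun n : ℕ => Ioi (n : ℝ))
    (fun n => measurableSet_Ioi.nullMeasurableSet)
    (fun m n hmn => Ioi_subset_Ioi (Nat.cast_le.2 hmn))
    ⟨0, by simpa [← hκ 0] using h.ne⟩
  have hempty : ⋂ n : ℕ, Ioi (n : ℝ) = ∅ := by
    refine eq_empty_of_forall_notMem fun s hs => ?_
    obtain ⟨n, hn⟩ := exists_nat_gt s
    exact absurd (mem_iInter.1 hs n) (not_lt.2 hn.le)
  rw [hempty, measure_empty] at this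
  refine this.congr fun n => ?_
  simpa using hκ n

/-- The probability that the whole integral is finite does not change along the process. -/
theorem IsLevyProcess.integralLaw_finite_ae_eq [IsProbabilityMeasure P] (hξ : IsLevyProcess P ξ)
    (hg : Measurable g)
    (hfin : FiniteOnBounded P ξ g) (y : ℝ) (t : ℝ≥0) :
    ∀ᵐ ω ∂P, integralLaw P ξ g (Iio ∞) (y + ξ t ω) = integralLaw P ξ g (Iio ∞) y := by
  have hpm := hξ.isProbabilityMeasure_map_path
  have hm := measurable_integralLaw hξ hg (measurableSet_Iio (a := (∞ : ℝ≥0∞)))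
  set H := integralLaw P ξ g (Iio ∞) with hH
  have hH1 : ∀ y, H y ≤ 1 := fun y => prob_le_one
  have hHt : ∀ y, H y ≠ ∞ := fun y => ((hH1 y).trans_lt ENNReal.one_lt_top).ne
  -- The mass up to time t is almost surely finite, so the whole integral is finite exactly when its
  -- tail is.
  have hharm : ∀ y, H y = ∫⁻ ω, H (y + ξ t ω) ∂P := fun y => by
    rw [hH, ← hξ.measure_tailIntegral_mem hg measurableSet_Iio,
      ← hξ.measure_tailIntegral_zero_mem hg measurableSet_Iio]
    refine measure_congr ?_
    filter_upwards [hfin.tailIntegral_zero_lt_top y t] with ω hω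
    exact propext ⟨fun h => (tailIntegral_anti y ω (zero_le)).trans_lt h, hω⟩
  have hprob : IsProbabilityMeasure (P.map (ξ t)) :=
    Measure.isProbabilityMeasure_map (hξ.measurable t).aemeasurable
  have h := ae_eq_of_harmonic (ν := P.map (ξ t)) (h := fun y => (H y).toReal)
    hm.ennreal_toReal (fun y => ENNReal.toReal_nonneg)
    (fun y => ENNReal.toReal_mono ENNReal.one_ne_top (hH1 y)) (fun y => by
      rw [integral_toReal (f := fun z => H (y + z)) (hm.comp (measurable_const_add y)).aemeasurable
        (Eventually.of_forall fun z => (hHt _).lt_top),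
        lintegral_map (f := fun z => H (y + z)) (hm.comp (measurable_const_add y)) (hξ.measurable t)]
      exact congrArg _ (hharm y)) y
  filter_upwards [ae_of_ae_map (hξ.measurable t).aemeasurable h] with ω hω
  exact (ENNReal.toReal_eq_toReal_iff' (hHt _) (hHt _)).1 hω

theorem IsLevyProcess.aemeasurable_occupation [IsProbabilityMeasure P] (hξ : IsLevyProcess P ξ)
    {F : ℝ → ℝ≥0∞}
    (hF : Measurable F) (x : ℝ) :
    AEMeasurable (fun p : ℝ × Ω => F (x + ξ p.1.toNNReal p.2))
      ((volume.restrict (Ioi (0 : ℝ))).prod P) :=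
  hF.comp_aemeasurable (hξ.aemeasurable_prod.const_add x)

theorem IsLevyProcess.lintegral_occupation_comm [IsProbabilityMeasure P] (hξ : IsLevyProcess P ξ)
    {F : ℝ → ℝ≥0∞}
    (hF : Measurable F) (x : ℝ) :
    ∫⁻ ω, (∫⁻ s in Ioi (0 : ℝ), F (x + ξ s.toNNReal ω)) ∂P =
      ∫⁻ s in Ioi (0 : ℝ), ∫⁻ ω, F (x + ξ s.toNNReal ω) ∂P :=
  (lintegral_lintegral_swap (f := fun s ω => F (x + ξ (Real.toNNReal s) ω))
    (hξ.aemeasurable_occupation hF x)).symm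

/-- Joint measurability in time and outcome, needed to exchange the integrals in the next bound. -/
theorem IsLevyProcess.aemeasurable_remaining (hξ : IsLevyProcess P ξ) (hg : Measurable g)
    (x : ℝ) :
    AEMeasurable (fun p : ℝ × Ω => {ω | tailIntegral ξ g x p.1.toNNReal ω ≤ 1}.indicator
      (fun ω => g (x + ξ p.1.toNNReal ω)) p.2) ((volume.restrict (Ioi (0 : ℝ))).prod P) := by
  let T : ℝ × (ℝ≥0 → ℝ) → ℝ≥0∞ := fun p =>
    ∫⁻ u, if (p.1.toNNReal : ℝ) < u then g (x + rightEval u.toNNReal p.2) else 0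
  have hT : Measurable T := by
    refine Measurable.lintegral_prod_right' (f := fun q : (ℝ × (ℝ≥0 → ℝ)) × ℝ =>
      if (q.1.1.toNNReal : ℝ) < q.2 then g (x + rightEval q.2.toNNReal q.1.2) else 0) ?_
    refine Measurable.ite (measurableSet_lt (by fun_prop) (by fun_prop)) ?_ measurable_const
    refine hg.comp (Measurable.const_add ?_ x)
    exact measurable_rightEval.comp (f := fun q : (ℝ × (ℝ≥0 → ℝ)) × ℝ => (q.2.toNNReal, q.1.2))
      (by fun_prop)
  have hG : Measurable fun p : ℝ × (ℝ≥0 → ℝ) =>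
      {p | T p ≤ 1}.indicator (fun p => g (x + rightEval p.1.toNNReal p.2)) p := by
    refine Measurable.indicator (hg.comp (Measurable.const_add ?_ x))
      (measurableSet_le hT measurable_const)
    exact measurable_rightEval.comp (f := fun q : ℝ × (ℝ≥0 → ℝ) => (q.1.toNNReal, q.2))
      (by fun_prop)
  refine ⟨_, hG.comp (measurable_fst.prodMk (hξ.measurable_path.comp measurable_snd)), ?_⟩
  have h := (Measure.quasiMeasurePreserving_snd
      (μ := volume.restrict (Ioi (0 : ℝ))) (ν := P)).ae hξ.rightCts
  filter_upwards [h] with p hp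
  have hR : ∀ s : ℝ≥0, rightEval s (fun s => ξ s p.2) = ξ s p.2 := fun s => rightEval_eq (hp s)
  have hTe : T (p.1, fun s => ξ s p.2) = tailIntegral ξ g x p.1.toNNReal p.2 := by
    simp only [T, tailIntegral, hR]
    rw [← lintegral_indicator measurableSet_Ioi]
    rfl
  simp only [Function.comp, indicator, hR, mem_ofPred_eq, hTe]

/-- The expected time integral of `g`, weighted by the probability that the remaining integral is
at most one, is at most one. -/
theorem IsLevyProcess.lintegral_mul_integralLaw_le_one [IsProbabilityMeasure P]
    (hξ : IsLevyProcess P ξ)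
    (hg : Measurable g) (x : ℝ) :
    ∫⁻ ω, (∫⁻ s in Ioi (0 : ℝ),
      g (x + ξ s.toNNReal ω) * integralLaw P ξ g (Iic 1) (x + ξ s.toNNReal ω)) ∂P ≤ 1 := by
  have hm := measurable_integralLaw hξ hg (measurableSet_Iic (a := (1 : ℝ≥0∞)))
  rw [hξ.lintegral_occupation_comm (F := fun y => g y * integralLaw P ξ g (Iic 1) y)
    (hg.mul hm) x]
  -- The Markov property turns the weight into the event that the actual remaining integral is at
  -- most 1; the pathwise bound then applies after exchanging integrals.
  have key : ∀ t : ℝ≥0, ∫⁻ ω, g (x + ξ t ω) * integralLaw P ξ g (Iic 1) (x + ξ t ω) ∂P =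
      ∫⁻ ω, {ω | tailIntegral ξ g x t ω ≤ 1}.indicator (fun ω => g (x + ξ t ω)) ω ∂P := by
    intro t
    have hA : MeasurableSet {p : ℝ × (ℝ≥0 → ℝ) | pathIntegral g (x + p.1) p.2 ∈ Iic 1} :=
      (measurable_pathIntegral hg).comp (f := fun p : ℝ × (ℝ≥0 → ℝ) => (x + p.1, p.2))
        (by fun_prop) measurableSet_Iic
    have hGm : Measurable fun p : ℝ × (ℝ≥0 → ℝ) =>
        g (x + p.1) * indicator {p : ℝ × (ℝ≥0 → ℝ) | pathIntegral g (x + p.1) p.2 ∈ Iic 1} 1 p :=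
      (hg.comp (by fun_prop)).mul (measurable_one.indicator hA)
    have h := hξ.setLIntegral_shift t MeasurableSet.univ hGm
    simp only [Measure.restrict_univ] at h
    calc _ = _ := lintegral_congr fun ω => ?_
      _ = _ := h.symm
      _ = _ := lintegral_congr_ae ?_
    · have hB' : MeasurableSet {w | pathIntegral g (x + ξ t ω) w ∈ Iic 1} :=
        measurable_prodMk_left hA
      rw [integralLaw, ← lintegral_indicator_one hB']
      exact (lintegral_const_mul (g (x + ξ t ω)) (measurable_one.indicator hB')).symm
    · filter_upwards [hξ.tailIntegral_eq g] with ω hω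
      by_cases hle : tailIntegral ξ g x t ω ≤ 1
      · have : pathIntegral g (x + ξ t ω) (shift ξ t ω) ≤ 1 := by rwa [← hω x t]
        simp [indicator, hle, this]
      · have : ¬ pathIntegral g (x + ξ t ω) (shift ξ t ω) ≤ 1 := by rwa [← hω x t]
        simp [indicator, hle, this]
  simp_rw [key]
  rw [← lintegral_lintegral_swap (f := fun ω s =>
    {ω | tailIntegral ξ g x (Real.toNNReal s) ω ≤ 1}.indicator
      (fun ω => g (x + ξ s.toNNReal ω)) ω) (hξ.aemeasurable_remaining hg x).prod_swap]
  refine (lintegral_mono fun ω => ?_).trans (by simp : ∫⁻ _, 1 ∂P ≤ 1)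
  refine le_trans (setLIntegral_mono' measurableSet_Ioi fun s hs => ?_)
    (setLIntegral_indicator_remaining_le_one fun s => g (x + ξ s.toNNReal ω))
  have hs' : ((s.toNNReal : ℝ≥0) : ℝ) = s := Real.coe_toNNReal s (le_of_lt hs)
  simp only [indicator, tailIntegral, mem_ofPred_eq, hs']
  exact le_rfl

end ProcessFunctionals

/-! ### The integral test -/

section IntegralTest

variable {Ω : Type*} [MeasurableSpace Ω] {P : Measure Ω} [IsProbabilityMeasure P]
  {ξ : ℝ≥0 → Ω → ℝ} {g : ℝ → ℝ≥0∞}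

/-- If the integral of `g` along `x + ξ` is finite with positive probability, then `x + ξ`
eventually stays in a closed set on which the expected time integral of `g` is finite. -/
theorem IsLevyProcess.exists_transient_compl (hξ : IsLevyProcess P ξ) (hg : Measurable g)
    (hfin : FiniteOnBounded P ξ g) (hlsc : LowerSemicontinuous (integralLaw P ξ g (Ioi 1)))
    {x : ℝ} (hx : integralLaw P ξ g (Iio ∞) x ≠ 0) :
    ∃ E : Set ℝ, MeasurableSet E ∧ IsTransientFrom P ξ x Eᶜ ∧
      ∫⁻ ω, (∫⁻ s in Ioi (0 : ℝ), E.indicator g (x + ξ s.toNNReal ω)) ∂P < ∞ := by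
  have hpm := hξ.isProbabilityMeasure_map_path
  set p := integralLaw P ξ g (Iio ∞) x with hp
  have hp1 : p ≤ 1 := prob_le_one
  have hpt : p ≠ ∞ := (hp1.trans_lt ENNReal.one_lt_top).ne
  have hp2 : p / 2 ≠ 0 := (ENNReal.div_pos hx ENNReal.ofNat_ne_top).ne'
  have hp2' : p / 2 ≤ 1 := ENNReal.half_le_self.trans hp1
  have hp2t : p / 2 ≠ ∞ := (hp2'.trans_lt ENNReal.one_lt_top).ne
  set ψ := integralLaw P ξ g (Ioi 1) with hψ
  have hsum : ∀ y, integralLaw P ξ g (Iic 1) y = 1 - ψ y := fun y => by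
    have hB : MeasurableSet {w | pathIntegral g y w ∈ Ioi 1} :=
      measurable_prodMk_left (measurable_pathIntegral hg measurableSet_Ioi)
    rw [hψ, integralLaw, integralLaw, ← prob_compl_eq_one_sub hB]
    congr 1
    ext w
    simp
  -- The threshold halves p: on `O` the integral is at most 1 with probability at most p/2, leaving
  -- p/2 for finite values above 1; off `O` that probability is at least p/2.
  set O : Set ℝ := ψ ⁻¹' Ioi (1 - p / 2) with hOdef
  have hO : IsOpen O := hlsc.isOpen_preimage _
  have hbig : ∀ y ∈ O, integralLaw P ξ g (Iio ∞) y = p →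
      p / 2 ≤ integralLaw P ξ g (Ioo 1 ∞) y := by
    intro y hy hyp
    have h1 : integralLaw P ξ g (Iic 1) y ≤ p / 2 := by
      rw [hsum]
      exact tsub_le_iff_left.2 (tsub_le_iff_right.1 (le_of_lt hy))
    have h2 : p ≤ integralLaw P ξ g (Iic 1) y + integralLaw P ξ g (Ioo 1 ∞) y := by
      rw [← hyp]
      refine (measure_mono fun w hw => ?_).trans (measure_union_le _ _)
      rcases le_or_gt (pathIntegral g y w) 1 with h | h
      · exact Or.inl h
      · exact Or.inr ⟨h, hw⟩
    have h3 := h2.trans (add_le_add_left h1 _)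
    rw [← ENNReal.add_halves p] at h3
    exact (ENNReal.add_le_add_iff_left hp2t).1 (by simpa using h3)
  let V : ℕ → Set Ω := fun n =>
    {ω | 1 < tailIntegral ξ g x n ω ∧ tailIntegral ξ g x 0 ω < ∞}
  have hmax : ∀ n : ℕ, p / 2 * P {ω | ∃ t ∈ Ici (n : ℝ≥0), ξ t ω ∈ (x + ·) ⁻¹' O} ≤ P (V n) := by
    intro n
    refine hξ.mul_measure_exists_mem_le (hO.preimage (continuous_const_add x)) (fun t ht => ?_)
      fun t ht C hC hCO => ?_
    · exact mem_of_superset self_mem_nhdsWithin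
        (Ioi_subset_Ici_self.trans (Ici_subset_Ici.2 ht))
    · calc p / 2 * P C = ∫⁻ _ in C, p / 2 ∂P := by simp
        _ ≤ ∫⁻ ω in C, integralLaw P ξ g (Ioo 1 ∞) (x + ξ t ω) ∂P := by
            refine lintegral_mono_ae ?_
            filter_upwards [ae_restrict_mem (hξ.past_le t _ hC),
              ae_restrict_of_ae (hξ.integralLaw_finite_ae_eq hg hfin x t)] with ω hωC hω
            exact hbig _ (hCO ω hωC) hω
        _ = P (C ∩ {ω | tailIntegral ξ g x t ω ∈ Ioo 1 ∞}) :=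
            (hξ.measure_inter_tailIntegral_mem hg measurableSet_Ioo x t hC).symm
        _ ≤ P (C ∩ V n) := by
            refine measure_mono_ae ?_
            filter_upwards [hfin.tailIntegral_zero_lt_top x t] with ω hω h
            exact ⟨h.1, h.2.1.trans_le (tailIntegral_anti x ω ht), hω h.2.2⟩
  -- The events decrease to the empty set, since the tails of a finite integral tend to 0.
  have hVlim : Tendsto (fun n => P (V n)) atTop (𝓝 0) := by
    have hVm : ∀ n, NullMeasurableSet (V n) P := fun n =>
      (nullMeasurableSet_lt aemeasurable_const (hξ.aemeasurable_tailIntegral hg x n)).inter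
        (nullMeasurableSet_lt (hξ.aemeasurable_tailIntegral hg x 0) aemeasurable_const)
    have := tendsto_measure_iInter_atTop (μ := P) hVm
      (fun m n hmn ω hω => ⟨hω.1.trans_le (tailIntegral_anti x ω (Nat.cast_le.2 hmn)), hω.2⟩)
      ⟨0, measure_ne_top _ _⟩
    have hempty : ⋂ n, V n = ∅ := by
      refine eq_empty_of_forall_notMem fun ω hω => ?_
      have hV := mem_iInter.1 hω
      obtain ⟨n, hn⟩ := ((tendsto_tailIntegral (hV 0).2).eventually
        (gt_mem_nhds (zero_lt_one' ℝ≥0∞))).exists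
      exact absurd (hV n).1 (not_lt.2 hn.le)
    rwa [hempty, measure_empty] at this
  refine ⟨Oᶜ, hO.measurableSet.compl, ?_, ?_⟩
  · have hsub : ∀ n : ℕ, p / 2 * P {ω | ¬ ∃ τ : ℝ≥0, ∀ s, τ ≤ s → x + ξ s ω ∈ Oᶜᶜᶜ} ≤ P (V n) := by
      intro n
      refine le_trans ?_ (hmax n)
      refine mul_le_mul_right (measure_mono fun ω hω => ?_) _
      by_contra hcon
      refine hω ⟨n, fun s hs hmem => hcon ⟨s, hs, ?_⟩⟩
      simpa using hmem
    have hz := ge_of_tendsto' hVlim hsub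
    exact (mul_eq_zero.1 (le_antisymm hz zero_le)).resolve_left hp2
  · have hle : p / 2 * ∫⁻ ω, (∫⁻ s in Ioi (0 : ℝ), Oᶜ.indicator g (x + ξ s.toNNReal ω)) ∂P ≤ 1 := by
      rw [← lintegral_const_mul' _ _ hp2t]
      refine (lintegral_mono fun ω => ?_).trans (hξ.lintegral_mul_integralLaw_le_one hg x)
      rw [← lintegral_const_mul' _ _ hp2t]
      refine lintegral_mono fun s => ?_
      by_cases hy : x + ξ s.toNNReal ω ∈ O
      · simp [indicator, hy]
      · rw [indicator_of_mem (by exact hy), mul_comm, hsum]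
        gcongr
        have h1 : ψ (x + ξ s.toNNReal ω) ≤ 1 - p / 2 := not_lt.1 hy
        calc p / 2 = 1 - (1 - p / 2) := (ENNReal.sub_sub_cancel ENNReal.one_ne_top hp2').symm
          _ ≤ _ := tsub_le_tsub_left h1 1
    refine lt_top_iff_ne_top.2 fun htop => ?_
    rw [htop, ENNReal.mul_top hp2] at hle
    exact absurd hle (by simp)

/-- Transports integrals and almost-everywhere statements between the potential measure and the
product of time and probability. -/
theorem IsLevyProcess.potentialMeasure_eq_map (hξ : IsLevyProcess P ξ) :
    potentialMeasure P ξ = Measure.map (fun p : ℝ × Ω => ξ p.1.toNNReal p.2)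
      ((volume.restrict (Ioi (0 : ℝ))).prod P) := by
  ext A hA
  have h := hξ.aemeasurable_occupation (measurable_one.indicator hA : Measurable
    (A.indicator (1 : ℝ → ℝ≥0∞))) 0
  simp only [zero_add] at h
  rw [potentialMeasure_apply hξ hA, ← lintegral_indicator_one hA,
    lintegral_map' (measurable_one.indicator hA).aemeasurable hξ.aemeasurable_prod,
    lintegral_prod _ h]
  refine lintegral_congr fun s => ?_
  exact (lintegral_indicator_one (hξ.measurable s.toNNReal hA)).symm

theorem IsLevyProcess.ae_prod_notMem (hξ : IsLevyProcess P ξ) {N : Set ℝ}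
    (hN : MeasurableSet N) (hNc : NotCharged P ξ N) (x : ℝ) :
    ∀ᵐ y ∂potentialMeasure P ξ, x + y ∉ N := by
  have hm : MeasurableSet {y | x + y ∈ N} := measurable_const_add x hN
  rw [ae_iff]
  simp only [not_not]
  rw [potentialMeasure_apply hξ hm]
  refine (setLIntegral_congr_fun measurableSet_Ioi fun s hs => ?_).trans lintegral_zero
  exact hNc _ (Real.toNNReal_pos.2 hs) x

theorem IsLevyProcess.ae_ae_notMem (hξ : IsLevyProcess P ξ) {N : Set ℝ}
    (hN : MeasurableSet N) (hNc : NotCharged P ξ N) (x : ℝ) :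
    ∀ᵐ ω ∂P, ∀ᵐ s ∂(volume.restrict (Ioi (0 : ℝ))), x + ξ s.toNNReal ω ∉ N := by
  have h := hξ.ae_prod_notMem hN hNc x
  rw [hξ.potentialMeasure_eq_map] at h
  have h1 := ae_of_ae_map hξ.aemeasurable_prod h
  exact Measure.ae_ae_of_ae_prod
    (Measure.measurePreserving_swap.quasiMeasurePreserving.ae h1)

theorem IsLevyProcess.potentialIntegral_eq (hξ : IsLevyProcess P ξ) (hg : Measurable g)
    {N : Set ℝ} (hN : MeasurableSet N) (hNc : NotCharged P ξ N) {f : ℝ → ℝ≥0}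
    (hfg : ∀ y ∉ N, (f y : ℝ≥0∞) = g y) (x : ℝ) {E : Set ℝ} (hE : MeasurableSet E) :
    potentialIntegral P ξ f x E =
      ∫⁻ ω, (∫⁻ s in Ioi (0 : ℝ), E.indicator g (x + ξ s.toNNReal ω)) ∂P := by
  have hF : Measurable (E.indicator g) := hg.indicator hE
  have hFx : Measurable fun y => E.indicator g (x + y) := hF.comp (measurable_const_add x)
  have hEx : MeasurableSet {y | x + y ∈ E} := measurable_const_add x hE
  rw [hξ.lintegral_occupation_comm hF x, potentialIntegral, ← lintegral_indicator hEx]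
  have : ∀ᵐ y ∂potentialMeasure P ξ, {y | x + y ∈ E}.indicator (fun y => (f (x + y) : ℝ≥0∞)) y =
      E.indicator g (x + y) := by
    filter_upwards [hξ.ae_prod_notMem hN hNc x] with y hy
    by_cases hyE : x + y ∈ E
    · simp [indicator, hyE, hfg _ hy]
    · simp [indicator, hyE]
  rw [lintegral_congr_ae this, hξ.potentialMeasure_eq_map,
    lintegral_map' hFx.aemeasurable hξ.aemeasurable_prod,
    lintegral_prod _ (hξ.aemeasurable_occupation hF x)]

/-- The integral test for `f` follows from semicontinuity in the starting point of the law of the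
integral of a Borel version of `f`. -/
theorem IsLevyProcess.integralTest (hξ : IsLevyProcess P ξ) (hg : Measurable g)
    {N : Set ℝ} (hN : MeasurableSet N) (hNc : NotCharged P ξ N) {f : ℝ → ℝ≥0}
    (hfg : ∀ y ∉ N, (f y : ℝ≥0∞) = g y) (hfin : FiniteHorizon P ξ f)
    (hlsc : LowerSemicontinuous (integralLaw P ξ g (Ioi 1))) : IntegralTest P ξ f := by
  intro x
  have hperp : ∀ᵐ ω ∂P, perpetualIntegral ξ f x ω = tailIntegral ξ g x 0 ω := by
    filter_upwards [hξ.ae_ae_notMem hN hNc x] with ω hω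
    rw [perpetualIntegral, tailIntegral, NNReal.coe_zero]
    exact lintegral_congr_ae (hω.mono fun s hs => hfg _ hs)
  have hfin' : FiniteOnBounded P ξ g := by
    intro t ht x
    filter_upwards [hξ.ae_ae_notMem hN hNc x, hfin t ht x] with ω hω h
    rw [horizonIntegral] at h
    rwa [← lintegral_congr_ae ((ae_restrict_of_ae_restrict_of_subset Ioc_subset_Ioi_self hω).mono
      fun s hs => hfg _ hs)]
  -- After some integer time the path lies in `E`, so the tail is dominated by the integral over
  -- visits to `E`.
  have hsuff : ∀ E : Set ℝ, MeasurableSet E → IsTransientFrom P ξ x Eᶜ →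
      potentialIntegral P ξ f x E < ∞ → ∀ᵐ ω ∂P, perpetualIntegral ξ f x ω < ∞ := by
    intro E hE htr hlt
    rw [hξ.potentialIntegral_eq hg hN hNc hfg x hE] at hlt
    have hF : Measurable (E.indicator g) := hg.indicator hE
    have hae : AEMeasurable (fun ω => ∫⁻ s in Ioi (0 : ℝ), E.indicator g (x + ξ s.toNNReal ω)) P :=
      (hξ.aemeasurable_occupation hF x).prod_swap.lintegral_prod_right'
    filter_upwards [hperp, ae_lt_top' hae hlt.ne, htr,
      ae_all_iff.2 fun n : ℕ => hfin'.tailIntegral_zero_lt_top x n] with ω h1 h2 ⟨τ, hτ⟩ h3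
    rw [h1]
    obtain ⟨n, hn⟩ := exists_nat_ge τ
    refine h3 n (lt_of_le_of_lt ?_ h2)
    rw [tailIntegral]
    refine le_trans (setLIntegral_mono' measurableSet_Ioi fun s hs => ?_)
      (lintegral_mono_set (Ioi_subset_Ioi (n : ℝ≥0).coe_nonneg))
    have hmem : x + ξ s.toNNReal ω ∈ E := by
      have := hτ s.toNNReal (hn.trans (NNReal.le_toNNReal_of_coe_le (le_of_lt hs)))
      simpa using this
    rw [indicator_of_mem hmem]
  have hnec : P {ω | perpetualIntegral ξ f x ω < ∞} ≠ 0 → ∃ E : Set ℝ, MeasurableSet E ∧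
      IsTransientFrom P ξ x Eᶜ ∧ potentialIntegral P ξ f x E < ∞ := by
    intro hne
    have : integralLaw P ξ g (Iio ∞) x ≠ 0 := by
      rw [← hξ.measure_tailIntegral_zero_mem hg measurableSet_Iio]
      refine fun h0 => hne ?_
      rw [← h0]
      refine measure_congr ?_
      filter_upwards [hperp] with ω hω
      refine propext ?_
      change perpetualIntegral ξ f x ω < ∞ ↔ tailIntegral ξ g x 0 ω < ∞
      rw [hω]
    obtain ⟨E, hE, htr, hlt⟩ := hξ.exists_transient_compl hg hfin' hlsc this
    exact ⟨E, hE, htr, (hξ.potentialIntegral_eq hg hN hNc hfg x hE).trans_lt hlt⟩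
  refine ⟨⟨fun h0 E hE htr => ?_, fun h => ?_⟩, fun ⟨E, hE, htr, hlt⟩ => hsuff E hE htr hlt⟩
  · by_contra hne
    have hae := hsuff E hE htr (lt_top_iff_ne_top.2 hne)
    have h1 : P {ω | perpetualIntegral ξ f x ω < ∞} = 1 := by
      rw [← measure_univ (μ := P)]
      exact measure_congr (hae.mono fun ω h => propext ⟨fun _ => trivial, fun _ => h⟩)
    rw [h0] at h1
    exact zero_ne_one h1
  · by_contra hne
    obtain ⟨E, hE, htr, hlt⟩ := hnec hne
    exact hlt.ne (h E hE htr)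

end IntegralTest

/-! ### Semicontinuity of the law of the integral -/

section Semicontinuity

theorem lowerSemicontinuous_lintegral {α : Type*} [MeasurableSpace α] {μ : Measure α}
    {F : ℝ → α → ℝ≥0∞} (hm : ∀ y, Measurable (F y))
    (hF : ∀ a, LowerSemicontinuous fun y => F y a) :
    LowerSemicontinuous fun y => ∫⁻ a, F y a ∂μ := by
  rw [lowerSemicontinuous_iff_le_liminf]
  intro y
  exact (lintegral_mono fun a => (hF a).le_liminf y).trans (lintegral_liminf_le hm)

/-- Fatou is applied twice: to the integral along each fixed path, and then to the indicator of the
set of starting points where that integral exceeds 1, which is open because the inequality is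
strict. -/
theorem lowerSemicontinuous_integralLaw {Ω : Type*} [MeasurableSpace Ω] {P : Measure Ω}
    {ξ : ℝ≥0 → Ω → ℝ} {g : ℝ → ℝ≥0∞} (hg : LowerSemicontinuous g) :
    LowerSemicontinuous (integralLaw P ξ g (Ioi 1)) := by
  have hpath : ∀ w, LowerSemicontinuous fun y => pathIntegral g y w := fun w => by
    refine lowerSemicontinuous_lintegral (F := fun y s => g (y + rightEval (Real.toNNReal s) w))
      (fun y => ?_) fun s => hg.comp (continuous_add_const _)
    refine hg.measurable.comp (Measurable.const_add ?_ y)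
    exact measurable_rightEval.comp (f := fun s : ℝ => (s.toNNReal, w)) (by fun_prop)
  have hB : ∀ y, MeasurableSet {w | pathIntegral g y w ∈ Ioi 1} := fun y =>
    measurable_prodMk_left (measurable_pathIntegral hg.measurable measurableSet_Ioi)
  have heq : integralLaw P ξ g (Ioi 1) = fun y =>
      ∫⁻ w, {w | pathIntegral g y w ∈ Ioi 1}.indicator 1 w ∂(P.map fun ω s => ξ s ω) := by
    ext y
    rw [lintegral_indicator_one (hB y), integralLaw]
  rw [heq]
  refine lowerSemicontinuous_lintegral (fun y => measurable_one.indicator (hB y)) fun w => ?_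
  exact ((hpath w).isOpen_preimage 1).lowerSemicontinuous_indicator (y := (1 : ℝ≥0∞)) zero_le

/-- Averaging a bounded function against an absolutely continuous law makes it continuous. -/
theorem continuous_integral_add_of_absolutelyContinuous {ν : Measure ℝ} [IsProbabilityMeasure ν]
    (hν : ν ≪ volume) {u : ℝ → ℝ} (hu : Measurable u) (hu1 : ∀ y, |u y| ≤ 1) :
    Continuous fun y => ∫ z, u (y + z) ∂ν := by
  let p : ℝ → ℝ := fun z => (ν.rnDeriv volume z).toReal
  have hp : Integrable p volume := Measure.integrable_toReal_rnDeriv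
  have hsub : ∀ y : ℝ, MeasurePreserving (fun w : ℝ => w - y) volume volume := fun y =>
    measurePreserving_sub_right volume y
  let sh : ℝ → C(ℝ, ℝ) := fun y => ⟨fun w => w - y, by fun_prop⟩
  have hsh : Continuous sh :=
    ContinuousMap.continuous_of_continuous_uncurry _ (by
      change Continuous fun q : ℝ × ℝ => q.2 - q.1
      fun_prop)
  -- Translates of the density move continuously in L¹, and pairing with `u` is 1-Lipschitz because
  -- `u` is bounded by 1.
  let T : ℝ → Lp ℝ 1 (volume : Measure ℝ) := fun y =>
    Lp.compMeasurePreserving (sh y) (hsub y) (hp.toL1 p)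
  have hT : Continuous T :=
    Continuous.compMeasurePreservingLp continuous_const hsh hsub ENNReal.one_ne_top
  have hTp : ∀ y, T y =ᵐ[volume] fun w => p (w - y) := fun y =>
    (Lp.coeFn_compMeasurePreserving _ (hsub y)).trans
      ((hsub y).quasiMeasurePreserving.ae_eq_comp (Integrable.coeFn_toL1 hp))
  have hint : ∀ v : Lp ℝ 1 (volume : Measure ℝ), Integrable (fun w => v w * u w) volume :=
    fun v => (L1.integrable_coeFn v).mul_bdd hu.aestronglyMeasurable
      (Eventually.of_forall hu1)
  have hlip : LipschitzWith 1 fun v : Lp ℝ 1 (volume : Measure ℝ) => ∫ w, v w * u w := by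
    refine LipschitzWith.of_dist_le_mul fun v v' => ?_
    rw [NNReal.coe_one, one_mul, dist_eq_norm, dist_eq_norm, L1.norm_eq_integral_norm,
      ← integral_sub (hint v) (hint v')]
    refine norm_integral_le_of_norm_le (L1.integrable_coeFn (v - v')).norm ?_
    filter_upwards [Lp.coeFn_sub v v'] with w hw
    rw [hw, Pi.sub_apply, ← sub_mul, norm_mul]
    exact mul_le_of_le_one_right (norm_nonneg _) (hu1 w)
  convert hlip.continuous.comp hT using 1
  ext y
  have hT' : ∫ w, T y w * u w = ∫ w, p (w - y) * u w :=
    integral_congr_ae ((hTp y).mono fun w hw => by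
      dsimp only at hw ⊢
      rw [hw])
  rw [Function.comp, hT', ← integral_rnDeriv_smul hν,
    ← (hsub y).integral_comp (Homeomorph.subRight y).measurableEmbedding
      fun z => (ν.rnDeriv volume z).toReal • u (y + z)]
  refine integral_congr_ae (Eventually.of_forall fun w => ?_)
  simp [p]

theorem ChargesNoNullSet.map_absolutelyContinuous {Ω : Type*} [MeasurableSpace Ω]
    {P : Measure Ω} {ξ : ℝ≥0 → Ω → ℝ} (hξ : IsLevyProcess P ξ)
    (h : ChargesNoNullSet P ξ) {t : ℝ≥0} (ht : 0 < t) : P.map (ξ t) ≪ volume := by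
  refine Measure.AbsolutelyContinuous.mk fun A hA h0 => ?_
  rw [Measure.map_apply (hξ.measurable t) hA]
  have := h A h0 t ht 0
  simp only [zero_add] at this
  exact this

variable {Ω : Type*} [MeasurableSpace Ω] {P : Measure Ω} [IsProbabilityMeasure P]
  {ξ : ℝ≥0 → Ω → ℝ} {g : ℝ → ℝ≥0∞}

/-- Discarding the time before `τ n > 0` replaces ψ by its average against an absolutely continuous
law, which is continuous. As `τ n` decreases to 0 these averages increase to ψ, and a supremum of
continuous functions is lower semicontinuous. -/
theorem ChargesNoNullSet.lowerSemicontinuous_integralLaw (hξ : IsLevyProcess P ξ)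
    (h : ChargesNoNullSet P ξ) (hg : Measurable g) :
    LowerSemicontinuous (integralLaw P ξ g (Ioi 1)) := by
  have hpm := hξ.isProbabilityMeasure_map_path
  have hψm := measurable_integralLaw hξ hg (measurableSet_Ioi (a := (1 : ℝ≥0∞)))
  set ψ := integralLaw P ξ g (Ioi 1) with hψ
  have hψ1 : ∀ y, ψ y ≤ 1 := fun y => prob_le_one
  have hψt : ∀ y, ψ y < ∞ := fun y => (hψ1 y).trans_lt ENNReal.one_lt_top
  let τ : ℕ → ℝ≥0 := fun n => 1 / ((n : ℝ≥0) + 1)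
  have hτ0 : ∀ n, 0 < τ n := fun n => by positivity
  have hτa : Antitone τ := fun m n hmn => by
    simp only [τ]
    gcongr
  have hU : Ioi (0 : ℝ) = ⋃ n, Ioi (τ n : ℝ) := by
    ext s
    simp only [mem_Ioi, mem_iUnion]
    constructor
    · intro hs
      obtain ⟨n, hn⟩ := exists_nat_one_div_lt hs
      exact ⟨n, by simpa [τ] using hn⟩
    · rintro ⟨n, hn⟩
      exact (NNReal.coe_pos.2 (hτ0 n)).trans hn
  have hmono : ∀ y ω, Monotone fun n => tailIntegral ξ g y (τ n) ω := fun y ω m n hmn =>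
    tailIntegral_anti y ω (hτa hmn)
  have hsup : ∀ y ω, tailIntegral ξ g y 0 ω = ⨆ n, tailIntegral ξ g y (τ n) ω := fun y ω => by
    simp only [tailIntegral, NNReal.coe_zero]
    rw [hU, setLIntegral_iUnion_of_directed]
    exact directed_of_isDirected_le fun m n hmn =>
      Ioi_subset_Ioi (NNReal.coe_le_coe.2 (hτa hmn))
  have heq : ψ = fun y => ⨆ n, ∫⁻ ω, ψ (y + ξ (τ n) ω) ∂P := by
    ext y
    have hset : {ω | tailIntegral ξ g y 0 ω ∈ Ioi 1} =
        ⋃ n, {ω | tailIntegral ξ g y (τ n) ω ∈ Ioi 1} := by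
      ext ω
      simp only [mem_iUnion]
      change 1 < tailIntegral ξ g y 0 ω ↔ ∃ n, 1 < tailIntegral ξ g y (τ n) ω
      rw [hsup, lt_iSup_iff]
    rw [hψ, ← hξ.measure_tailIntegral_zero_mem hg measurableSet_Ioi, hset,
      Monotone.measure_iUnion (s := fun n => {ω | tailIntegral ξ g y (τ n) ω ∈ Ioi 1})
        fun m n hmn ω hω => lt_of_lt_of_le hω (hmono y ω hmn)]
    simp_rw [hξ.measure_tailIntegral_mem hg measurableSet_Ioi]
  rw [heq]
  refine lowerSemicontinuous_iSup fun n => Continuous.lowerSemicontinuous ?_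
  have hprob : IsProbabilityMeasure (P.map (ξ (τ n))) :=
    Measure.isProbabilityMeasure_map (hξ.measurable _).aemeasurable
  have hc := continuous_integral_add_of_absolutelyContinuous
    (h.map_absolutelyContinuous hξ (hτ0 n)) hψm.ennreal_toReal fun y => by
      rw [abs_of_nonneg ENNReal.toReal_nonneg]
      exact ENNReal.toReal_mono ENNReal.one_ne_top (hψ1 y)
  refine (ENNReal.continuous_ofReal.comp hc).congr fun y => ?_
  have hm' : Measurable fun z => ψ (y + z) := hψm.comp (measurable_const_add y)
  have hle : ∫⁻ z, ψ (y + z) ∂(P.map (ξ (τ n))) ≤ 1 :=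
    (lintegral_mono fun z => hψ1 _).trans (by simp)
  rw [Function.comp, integral_toReal hm'.aemeasurable (Eventually.of_forall fun z => hψt _),
    ENNReal.ofReal_toReal (hle.trans_lt ENNReal.one_lt_top).ne, lintegral_map hm' (hξ.measurable _)]

end Semicontinuity

/-! ### Boundedness of paths on bounded time intervals -/

section Boundedness

variable {Ω : Type*} [MeasurableSpace Ω] {P : Measure Ω} [IsProbabilityMeasure P]
  {ξ : ℝ≥0 → Ω → ℝ}

theorem IsLevyProcess.exists_measure_increment_le (hξ : IsLevyProcess P ξ) :
    ∃ δ > 0, ∀ u ≤ δ, P {ω | 1 < |ξ u ω - ξ 0 ω|} ≤ 1 / 2 := by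
  by_contra! hcon
  choose u hu hP using fun n : ℕ => hcon (1 / ((n : ℝ≥0) + 1)) (by positivity)
  have hu0 : Tendsto u atTop (𝓝 0) :=
    tendsto_of_tendsto_of_tendsto_of_le_of_le tendsto_const_nhds
      tendsto_one_div_add_atTop_nhds_zero_nat (fun n => zero_le) hu
  have hae : ∀ᵐ ω ∂P, Tendsto (fun n => ξ (u n) ω) atTop (𝓝 (ξ 0 ω)) := by
    filter_upwards [hξ.rightCts] with ω hω
    exact (hω 0).tendsto.comp
      (tendsto_nhdsWithin_iff.2 ⟨hu0, Eventually.of_forall fun n => mem_Ici.2 zero_le⟩)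
  have hmeas := tendstoInMeasure_of_tendsto_ae
    (fun n => (hξ.measurable (u n)).aestronglyMeasurable) hae
  rw [tendstoInMeasure_iff_norm] at hmeas
  have := ge_of_tendsto' (hmeas 1 one_pos) fun n => (hP n).le.trans
    (measure_mono (t := {ω | 1 ≤ ‖ξ (u n) ω - ξ 0 ω‖}) fun ω hω => mem_ofPred.2 (le_of_lt hω))
  simp at this

/-- Right-continuity alone does not bound a path on a compact time interval. This is an
Ottaviani-type argument: once |ξ_t| > n + 1, the independent increment up to δ is at most 1 in size
with probability at least 1/2, and then |ξ_δ| > n, which becomes improbable as n grows. -/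
theorem IsLevyProcess.ae_bounded_short (hξ : IsLevyProcess P ξ) {δ : ℝ≥0}
    (hδ : ∀ u ≤ δ, P {ω | 1 < |ξ u ω - ξ 0 ω|} ≤ 1 / 2) :
    ∀ᵐ ω ∂P, ∃ M : ℝ, ∀ s < δ, |ξ s ω| ≤ M := by
  have hmax : ∀ n : ℕ, 1 / 2 * P {ω | ∃ t ∈ Iio δ, ξ t ω ∈ {y | (n : ℝ) + 1 < |y|}} ≤
      P {ω | (n : ℝ) < |ξ δ ω|} := by
    intro n
    refine hξ.mul_measure_exists_mem_le (isOpen_lt continuous_const continuous_abs)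
      (fun t ht => mem_nhdsWithin_of_mem_nhds (Iio_mem_nhds ht)) fun t ht C hC hCO => ?_
    obtain ⟨A, hA, rfl⟩ := hC
    have ht' : t ≤ δ := le_of_lt ht
    have hD : MeasurableSet {w : ℝ≥0 → ℝ | |w (δ - t)| ≤ 1} :=
      measurableSet_le (by fun_prop) measurable_const
    have hshift : ∀ ω, shift ξ t ω (δ - t) = ξ δ ω - ξ t ω := fun ω => by
      rw [shift, add_tsub_cancel_of_le ht']
    have hhalf : 1 / 2 ≤ P (shift ξ t ⁻¹' {w | |w (δ - t)| ≤ 1}) := by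
      have hid := hξ.identDistrib_sub ht' (zero_le (a := δ - t)) (by simp)
      have hEm : MeasurableSet {y : ℝ | 1 < |y|} :=
        measurableSet_lt measurable_const (by fun_prop)
      have h1 : P {ω | 1 < |ξ δ ω - ξ t ω|} ≤ 1 / 2 :=
        (hid.measure_mem_eq hEm).trans_le (hδ _ tsub_le_self)
      have h2 : MeasurableSet {ω | 1 < |ξ δ ω - ξ t ω|} :=
        ((hξ.measurable δ).sub (hξ.measurable t)) hEm
      have h3 : shift ξ t ⁻¹' {w | |w (δ - t)| ≤ 1} = {ω | 1 < |ξ δ ω - ξ t ω|}ᶜ := by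
        ext ω
        simp [hshift]
      rw [h3, prob_compl_eq_one_sub h2]
      calc (1 / 2 : ℝ≥0∞) = 1 - 1 / 2 := by simp
        _ ≤ _ := tsub_le_tsub_left h1 1
    calc 1 / 2 * P ((fun ω (s : Iic t) => ξ s ω) ⁻¹' A)
        ≤ P ((fun ω (s : Iic t) => ξ s ω) ⁻¹' A) *
          P (shift ξ t ⁻¹' {w | |w (δ - t)| ≤ 1}) := by
          rw [mul_comm]
          gcongr
      _ = P ((fun ω (s : Iic t) => ξ s ω) ⁻¹' A ∩ shift ξ t ⁻¹' {w | |w (δ - t)| ≤ 1}) :=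
          ((hξ.indepFun_past_shift t).measure_inter_preimage_eq_mul _ _ hA hD).symm
      _ ≤ _ := by
          refine measure_mono fun ω hω => ⟨hω.1, ?_⟩
          have h1 : (n : ℝ) + 1 < |ξ t ω| := hCO ω hω.1
          have h2 : |ξ δ ω - ξ t ω| ≤ 1 := by
            have : |shift ξ t ω (δ - t)| ≤ 1 := hω.2
            rwa [hshift] at this
          have h3 := abs_sub_abs_le_abs_sub (ξ t ω) (ξ δ ω)
          rw [abs_sub_comm] at h3
          change (n : ℝ) < |ξ δ ω|
          linarith
  have hlim : Tendsto (fun n : ℕ => P {ω | (n : ℝ) < |ξ δ ω|}) atTop (𝓝 0) := by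
    have := tendsto_measure_iInter_atTop (μ := P) (s := fun n : ℕ => {ω | (n : ℝ) < |ξ δ ω|})
      (fun n => (measurableSet_lt measurable_const
        (hξ.measurable δ).abs).nullMeasurableSet)
      (fun m n hmn ω (hω : (n : ℝ) < _) => (Nat.cast_le.2 hmn).trans_lt hω)
      ⟨0, measure_ne_top _ _⟩
    have hempty : ⋂ n : ℕ, {ω | (n : ℝ) < |ξ δ ω|} = ∅ := by
      refine eq_empty_of_forall_notMem fun ω hω => ?_
      obtain ⟨n, hn⟩ := exists_nat_gt |ξ δ ω|
      exact lt_asymm hn (mem_iInter.1 hω n)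
    rwa [hempty, measure_empty] at this
  have hz := ge_of_tendsto' hlim fun n => le_trans (mul_le_mul_right (measure_mono
    (s := {ω | ¬ ∃ M : ℝ, ∀ s < δ, |ξ s ω| ≤ M}) fun ω hω => ?_) _) (hmax n)
  · exact (mul_eq_zero.1 (le_antisymm hz zero_le)).resolve_left (by simp)
  · by_contra hcon
    refine hω ⟨n + 1, fun s hs => ?_⟩
    by_contra hlt
    exact hcon ⟨s, hs, not_le.1 hlt⟩

/-- The short-time bound applies to the increments over each block of length δ, and finitely many
blocks cover a bounded interval. -/
theorem IsLevyProcess.ae_bounded (hξ : IsLevyProcess P ξ) :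
    ∀ᵐ ω ∂P, ∀ T : ℝ≥0, ∃ M : ℝ, ∀ s ≤ T, |ξ s ω| ≤ M := by
  obtain ⟨δ, hδ0, hδ⟩ := hξ.exists_measure_increment_le
  have hshort : ∀ k : ℕ, ∀ᵐ ω ∂P, ∃ M : ℝ, ∀ s < δ, |shift ξ (k * δ) ω s| ≤ M := fun k => by
    refine (hξ.isLevyProcess_shift (k * δ)).ae_bounded_short fun u hu => ?_
    refine le_trans (le_of_eq ?_) (hδ u hu)
    have hid := hξ.identDistrib_sub (le_self_add : k * δ ≤ k * δ + u) (zero_le (a := u)) (by simp)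
    have := hid.measure_mem_eq (s := {y : ℝ | 1 < |y|})
      (measurableSet_lt measurable_const (by fun_prop))
    simpa [shift] using this
  filter_upwards [ae_all_iff.2 hshort] with ω hω
  have hind : ∀ k : ℕ, ∃ M : ℝ, ∀ s < k * δ, |ξ s ω| ≤ M := by
    intro k
    induction k with
    | zero => exact ⟨0, fun s hs => by simp at hs⟩
    | succ k ih =>
      obtain ⟨M, hM⟩ := ih
      obtain ⟨M', hM'⟩ := hω k
      refine ⟨max M (|ξ (k * δ) ω| + M'), fun s hs => ?_⟩
      rcases lt_or_ge s (k * δ) with h | h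
      · exact (hM s h).trans (le_max_left _ _)
      · have h1 := hM' (s - k * δ) (by
          rw [tsub_lt_iff_left h]
          convert hs using 1
          push_cast
          ring)
        rw [shift, add_tsub_cancel_of_le h] at h1
        refine le_trans ?_ (le_max_right _ _)
        have := abs_sub_abs_le_abs_sub (ξ s ω) (ξ (k * δ) ω)
        linarith
  intro T
  obtain ⟨k, hk⟩ := exists_nat_gt (T / δ)
  obtain ⟨M, hM⟩ := hind k
  rw [div_lt_iff₀ hδ0] at hk
  exact ⟨M, fun s hs => hM s (hs.trans_lt hk)⟩

theorem LocallyBounded.finiteHorizon (hξ : IsLevyProcess P ξ) {f : ℝ → ℝ≥0}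
    (hf : LocallyBounded f) : FiniteHorizon P ξ f := by
  intro t ht x
  filter_upwards [hξ.ae_bounded] with ω hω
  obtain ⟨M, hM⟩ := hω t.toNNReal
  obtain ⟨B, hB⟩ := hf (Icc (x - M) (x + M)) isCompact_Icc
  refine lt_of_le_of_lt (setLIntegral_mono' (g := fun _ => (B : ℝ≥0∞)) measurableSet_Ioc
    fun s hs => ?_) (by simp [ENNReal.mul_lt_top_iff])
  have := abs_le.1 (hM s.toNNReal (Real.toNNReal_le_toNNReal hs.2))
  exact ENNReal.coe_le_coe.2 (hB (mem_image_of_mem f ⟨by linarith, by linarith⟩))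

end Boundedness

/-! ### The two classes of functions -/

section Classes

theorem IsOpenStepFunction.lowerSemicontinuous {g : ℝ → ℝ≥0} (hg : IsOpenStepFunction g) :
    LowerSemicontinuous fun y => (g y : ℝ≥0∞) := by
  obtain ⟨k, c, α, β, -, h⟩ := hg
  have : (fun y => (g y : ℝ≥0∞)) =
      fun y => ∑ j, (Ioo (α j) (β j)).indicator (fun _ => (c j : ℝ≥0∞)) y := by
    ext y
    rw [h, ENNReal.ofNNReal_finsetSum]
    simp only [indicator]
    exact Finset.sum_congr rfl fun j _ => by split_ifs <;> simp
  rw [this]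
  exact lowerSemicontinuous_sum fun j _ => isOpen_Ioo.lowerSemicontinuous_indicator zero_le

/-- The supremum of the step functions works. It may be infinite off `L`, hence the values in
`ℝ≥0∞`. -/
theorem IsMonotoneStepLimitOn.exists_lowerSemicontinuous {f : ℝ → ℝ≥0} {L : Set ℝ}
    (h : IsMonotoneStepLimitOn f L) :
    ∃ g : ℝ → ℝ≥0∞, LowerSemicontinuous g ∧ ∀ y ∈ L, (f y : ℝ≥0∞) = g y := by
  obtain ⟨g, hg, hmono, hlim⟩ := h
  refine ⟨fun y => ⨆ n, (g n y : ℝ≥0∞), lowerSemicontinuous_iSup fun n =>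
    (hg n).lowerSemicontinuous, fun y hy => ?_⟩
  exact tendsto_nhds_unique (ENNReal.tendsto_coe.2 (hlim y hy))
    (tendsto_atTop_iSup fun m n hmn => ENNReal.coe_le_coe.2 (hmono hmn y))

theorem chargesNoNullSet_of_absolutelyContinuous {Ω : Type*} [MeasurableSpace Ω] {P : Measure Ω}
    {ξ : ℝ≥0 → Ω → ℝ} (hξ : IsLevyProcess P ξ)
    (h : ∀ s : ℝ≥0, 0 < s → P.map (ξ s) ≪ volume) : ChargesNoNullSet P ξ := by
  intro A hA s hs x
  have h0 : volume ((x + ·) ⁻¹' A) = 0 := by rwa [measure_preimage_add]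
  exact Measure.preimage_null_of_map_null (hξ.measurable s).aemeasurable (h s hs h0)

variable {Ω : Type*} [MeasurableSpace Ω] {P : Measure Ω} [IsProbabilityMeasure P]
  {ξ : ℝ≥0 → Ω → ℝ} {f : ℝ → ℝ≥0}

theorem IsMonotoneStepLimitOn.integralTest (hξ : IsLevyProcess P ξ) {L : Set ℝ}
    (hL : MeasurableSet L) (hf : IsMonotoneStepLimitOn f L) (hLc : NotCharged P ξ Lᶜ)
    (hfin : FiniteHorizon P ξ f) : IntegralTest P ξ f := by
  obtain ⟨g, hg, hfg⟩ := hf.exists_lowerSemicontinuous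
  exact hξ.integralTest hg.measurable hL.compl hLc (fun y hy => hfg y (not_not.1 hy)) hfin
    (lowerSemicontinuous_integralLaw hg)

/-- The set where `f` differs from its Borel version is enclosed in a Borel null set, which is not
charged. -/
theorem ChargesNoNullSet.integralTest (hξ : IsLevyProcess P ξ) (h : ChargesNoNullSet P ξ)
    (hf : AEMeasurable f volume) (hfin : FiniteHorizon P ξ f) : IntegralTest P ξ f := by
  have hg : Measurable fun y => ((hf.mk f y : ℝ≥0) : ℝ≥0∞) := hf.measurable_mk.coe_nnreal_ennreal
  have h0 : volume {y | ¬ f y = hf.mk f y} = 0 := ae_iff.1 hf.ae_eq_mk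
  refine hξ.integralTest (g := fun y => ((hf.mk f y : ℝ≥0) : ℝ≥0∞)) hg
    (measurableSet_toMeasurable volume {y | ¬ f y = hf.mk f y})
    (h _ ((measure_toMeasurable _).trans h0)) (fun y hy => ?_) hfin
    (h.lowerSemicontinuous_integralLaw hξ hg)
  have : f y = hf.mk f y := by_contra fun hne => hy (subset_toMeasurable _ _ hne)
  rw [← this]

end Classes

end Perpetual

theorem corollary1 {Ω : Type*} [MeasurableSpace Ω] (P : Measure Ω) [IsProbabilityMeasure P]
    (ξ : ℝ≥0 → Ω → ℝ) (hξ : Perpetual.IsLevyProcess P ξ)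
    (hdrift : Perpetual.DriftsToInfinity P ξ) :
    -- locally bounded monotone limits of step functions, off a set that is not charged
    (∀ (f : ℝ → ℝ≥0) (L : Set ℝ), Perpetual.LocallyBounded f → MeasurableSet L →
      Perpetual.IsMonotoneStepLimitOn f L → Perpetual.NotCharged P ξ Lᶜ →
      Perpetual.IntegralTest P ξ f) ∧
    -- all locally bounded, measurable functions, if no Lebesgue-null set is charged
    (Perpetual.ChargesNoNullSet P ξ → ∀ f : ℝ → ℝ≥0, AEMeasurable f volume →
      Perpetual.LocallyBounded f → Perpetual.IntegralTest P ξ f) ∧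
    -- absolutely continuous one-dimensional marginals charge no Lebesgue-null set
    ((∀ s : ℝ≥0, 0 < s → P.map (ξ s) ≪ volume) → Perpetual.ChargesNoNullSet P ξ) ∧
    -- both claims for locally integrable functions with finite finite-horizon integrals
    (∀ (f : ℝ → ℝ≥0) (L : Set ℝ), LocallyIntegrable (fun y => (f y : ℝ)) volume →
      Perpetual.FiniteHorizon P ξ f → MeasurableSet L →
      Perpetual.IsMonotoneStepLimitOn f L → Perpetual.NotCharged P ξ Lᶜ →
      Perpetual.IntegralTest P ξ f) ∧
    (Perpetual.ChargesNoNullSet P ξ → ∀ f : ℝ → ℝ≥0,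
      LocallyIntegrable (fun y => (f y : ℝ)) volume →
      Perpetual.FiniteHorizon P ξ f → Perpetual.IntegralTest P ξ f) := by
  refine ⟨fun f L hf hL hfL hLc => hfL.integralTest hξ hL hLc (hf.finiteHorizon hξ),
    fun hc f hf hb => hc.integralTest hξ hf (hb.finiteHorizon hξ),
    Perpetual.chargesNoNullSet_of_absolutelyContinuous hξ,
    fun f L _ hfin hL hfL hLc => hfL.integralTest hξ hL hLc hfin,
    fun hc f hf hfin => hc.integralTest hξ ?_ hfin⟩
  -- Local integrability contains the almost-everywhere measurability required here.
  simpa using hf.aestronglyMeasurable.aemeasurable.real_toNNReal
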